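/- **Setting.** Let $A\in GL_2(\mathbb R)$, $q>0$, $\theta\in[0,2\pi)$, let $R_\phi$ be the rotation by $\phi$, and put $A_1=q^{-1/2}R_{-\theta/2}A$, $A_2=q^{1/2}R_{\theta/2}A$. For $j\in\{1,2\}$ let $\mathcal R_j=A_j\mathbb Z^2$, $\mathcal R_j(N)=A_j(\{-N,\dots,N\}^2)$, $\Gamma_j=A_j[0,1)^2$, $B_j=2\pi A_j^{-T}$, $D_j=I-A_{3-j}A_j^{-1}$; let $B_{\mathcal M}=B_1-B_2$, $\mathcal R_{\mathcal M}^*=B_{\mathcal M}\mathbb Z^2$, $A_{\mathcal M}=2\pi B_{\mathcal M}^{-T}$, $\Gamma_{\mathcal M}=A_{\mathcal M}[0,1)^2$. The angle $\theta$ is a $(q,K,\sigma)$-Diophantine 2D rotation if $K>0$, $\sigma>0$ and for all $n\in\mathbb Z^2\setminus\{0\}$ and both choices of sign $$\operatorname{dist}\big(q^{\mp1}A^TR_{\pm\theta}A^{-T}n,\ \mathbb Z^2\big)\ \ge\ \frac{K}{|n|^{2\sigma}} .$$ Let $\mathcal A_1,\mathcal A_2$ be finite sets with shift vectors $\tau_k^{(\alpha)}\in\mathbb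 R^2$ ($\alpha\in\mathcal A_k$), and let $u_k(\cdot,\alpha):\mathbb R^2\to\mathbb R^3$ be continuous and $A_{\mathcal M}\mathbb Z^2$-periodic for $k=1,2$, $\alpha\in\mathcal A_k$. Write $Y_k(x,\alpha)=x+\tau_k^{(\alpha)}+u_k(x,\alpha)$, with $\mathbb R^2\cong\mathbb R^2\times\{0\}\subset\mathbb R^3$. *Monolayer.* For functions $V_{j,\alpha}:(\mathbb R^3)^{\mathcal R_j\times\mathcal A_j}\to\mathbb R$ ($\alpha\in\mathcal A_j$) let $$\Phi_j^{(\mathrm{mono})}(x)=\frac1{|\Gamma_j|}\sum_{\alpha\in\mathcal A_j}V_{j,\alpha}\Big(\big(u_j(x+R',\alpha')-u_j(x,\alpha)\big)_{R'\in\mathcal R_j,\,\alpha'\in\mathcal A_j}\Big),$$ $$e^{(\mathrm{mono})}_{j,N}=\frac1{|\Gamma_j|(2N+1)^2}\sum_{\alpha\in\mathcal A_j}\ \sum_{R\in\mathcal R_j(N)}V_{j,\alpha}\Big(\big(u_j(R+R',\alpha')-u_j(R,\alpha)\big)_{R',\alpha'}\Big).$$ *Interlayer.* For functions $V_{j,\alpha}:(\mathbb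 R^3)^{\mathcal R_{3-j}\times\mathcal A_{3-j}}\to\mathbb R$ ($\alpha\in\mathcal A_j$) that are even and invariant under translations of the lattice index, let $$\Phi_j^{(\mathrm{inter})}(x)=\frac1{|\Gamma_j|}\sum_{\alpha\in\mathcal A_j}V_{j,\alpha}\Big(\big(D_jx-R'+\tau_j^{(\alpha)}-\tau_{3-j}^{(\alpha')}+u_j(x,\alpha)-u_{3-j}(x-D_jx+R',\alpha')\big)_{R'\in\mathcal R_{3-j},\,\alpha'\in\mathcal A_{3-j}}\Big),$$ $$e^{(\mathrm{inter})}_{j,N}=\frac1{|\Gamma_j|(2N+1)^2}\sum_{R\in\mathcal R_j(N)}\ \sum_{\alpha\in\mathcal A_j}V_{j,\alpha}\Big(\big(Y_j(R,\alpha)-Y_{3-j}(R',\alpha')\big)_{R'\in\mathcal R_{3-j},\,\alpha'\in\mathcal A_{3-j}}\Big).$$ In both cases $\ell\in\{\mathrm{mono},\mathrm{inter}\}$ let $e_j^{(\ell)}=\frac1{|\Gamma_{\mathcal M}|}\int_{\Gamma_{\mathcal M}}\Phi_j^{(\ell)}(x)\,dx$, and write $\hat f(G)=\frac1{|\Gamma_{\mathcal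 M}|}\int_{\Gamma_{\mathcal M}}e^{-iG\cdot x}f(x)\,dx$. *Pair potentials.* For even functions $v_{(\alpha_1,\alpha_2)}:\mathbb R^3\to\mathbb R$ ($\alpha_k\in\mathcal A_k$), the interlayer pair potential is $V_{j,\alpha_j}(a)=\frac12\sum_{R'\in\mathcal R_{3-j},\,\alpha_{3-j}\in\mathcal A_{3-j}}v_{(\alpha_1,\alpha_2)}(a_{R',\alpha_{3-j}})$. Let $L=\max_{\alpha_1,\alpha_2}|\tau_1^{(\alpha_1)}-\tau_2^{(\alpha_2)}|+\|u_{1,z}\|_\infty+\|u_{2,z}\|_\infty$. $W^{6,\infty}_{2r}(\Omega)$ is the space of functions $f$ such that $(1+|x|^2)^{r}D^mf\in L^\infty(\Omega)$ for $0\le m\le6$ (weak derivatives), and $W^{6,\infty}$ is the unweighted space. A function in $W^{6,\infty}_{2r}(\mathbb R^2\times[-L,L])$ is identified with its continuous representative on the closed slab; if $L=0$, the slab is the plane $\mathbb R^2\times\{0\}\cong\mathbb R^2$ and the space is $W^{6,\infty}_{2r}(\mathbb R^2)$. **Theorem.** Let $s>1$, $\sigma>\frac{1433}{1248}$, let $\theta\in[0,2\pi)$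 be a $(q,K,\sigma)$-Diophantine 2D rotation for some $K>0$, and let $j\in\{1,2\}$. 1. Let $\ell\in\{\mathrm{mono},\mathrm{inter}\}$. Assume that $\Phi_j^{(\ell)}$ is continuous, that $\Phi_j^{(\ell)}\in L^1(\Gamma_{\mathcal M})$, and that $\sup_{G\in\mathcal R_{\mathcal M}^*}|G|^{2(\sigma+s)}\,|\widehat{\Phi_j^{(\ell)}}(G)|<\infty$. Then there is a constant $C>0$ such that for all $N\in\mathbb N$ $$\big|e^{(\ell)}_{j,N}-e^{(\ell)}_j\big|\le\frac C{2N+1}.$$ 2. Consider interlayer pair potentials, and let $\sigma<2$ and $r>1$. Assume that $u_k(\cdot,\alpha_k)\in W^{6,\infty}(\mathbb R^2)$ and $v_{(\alpha_1,\alpha_2)}\in W^{6,\infty}_{2r}(\mathbb R^2\times[-L,L])$ for $k=1,2$ and all $\alpha_k\in\mathcal A_k$. Then the sums defining $\Phi_j^{(\mathrm{inter})}$ converge absolutely, $\Phi_j^{(\mathrm{inter})}\in L^1(\Gamma_{\mathcal M})$, and there is a constant $C>0$ such that for all $N\in\mathbb N$ $$\big|e^{(\mathrm{inter})}_{j,N}-e^{(\mathrm{inter})}_j\big|\le\frac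 C{2N+1}.$$ -/

import Mathlib

open MeasureTheory Set
open scoped ContDiff Matrix

namespace MoireBilayer

noncomputable section

/-- The two layers of the bilayer. -/
inductive Layer
  | one
  | two

/-- The opposite layer `3 - j`. -/
def Layer.other : Layer → Layer
  | .one => .two
  | .two => .one

/-- The plane, with its Euclidean norm. -/
abbrev R2 : Type := EuclideanSpace ℝ (Fin 2)

/-- Space, with its Euclidean norm; the coordinates `0, 1, 2` are `x, y, z`. -/
abbrev R3 : Type := EuclideanSpace ℝ (Fin 3)

/-- Integer vectors; they label the points `M n` of a lattice `M ℤ²`. -/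
abbrev Z2 : Type := Fin 2 → ℤ

/-- Real `2 × 2` matrices. -/
abbrev Mat2 : Type := Matrix (Fin 2) (Fin 2) ℝ

/-- Matrix times vector in the Euclidean plane. -/
def act (M : Mat2) (x : R2) : R2 := WithLp.toLp 2 (M *ᵥ x.ofLp)

/-- The inclusion `ℤ² ⊆ ℝ²`. -/
def intVec (n : Z2) : R2 := WithLp.toLp 2 (fun i => (n i : ℝ))

/-- The embedding `x ↦ (x, 0)` of the plane into space. -/
def toR3 (x : R2) : R3 := !₂[x 0, x 1, 0]

/-! ### Lattices -/

/-- Counterclockwise rotation by `φ`. -/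
def rot (φ : ℝ) : Mat2 := !![Real.cos φ, -Real.sin φ; Real.sin φ, Real.cos φ]

/-- `A₁ = q^{-1/2} R_{-θ/2} A` and `A₂ = q^{1/2} R_{θ/2} A`. -/
def layerMat (A : Mat2) (q θ : ℝ) : Layer → Mat2
  | .one => q ^ (-(1 / 2) : ℝ) • (rot (-(θ / 2)) * A)
  | .two => q ^ (1 / 2 : ℝ) • (rot (θ / 2) * A)

/-- The lattice point `A_j n`. -/
def latPt (A : Mat2) (q θ : ℝ) (j : Layer) (n : Z2) : R2 := act (layerMat A q θ j) (intVec n)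

/-- The half-open cell `M [0,1)²`. -/
def cell (M : Mat2) : Set R2 := act M '' {t | ∀ i, t i ∈ Ico (0 : ℝ) 1}

/-- The area `|Γ_j|` of the unit cell `Γ_j = A_j [0,1)²`. -/
def cellArea (A : Mat2) (q θ : ℝ) (j : Layer) : ℝ := (volume (cell (layerMat A q θ j))).toReal

/-- The reciprocal matrix `2π M^{-T}`. -/
def recip (M : Mat2) : Mat2 := (2 * Real.pi) • (M⁻¹)ᵀ

/-- `B_M = B₁ - B₂`, with `B_j = 2π A_j^{-T}`; its columns generate the moire frequency lattice. -/
def moireFreqMat (A : Mat2) (q θ : ℝ) : Mat2 :=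
  recip (layerMat A q θ .one) - recip (layerMat A q θ .two)

/-- `A_M = 2π B_M^{-T}`; its columns generate the moire lattice. -/
def moireMat (A : Mat2) (q θ : ℝ) : Mat2 := recip (moireFreqMat A q θ)

/-- The moire unit cell `Γ_M = A_M [0,1)²`. -/
def moireCell (A : Mat2) (q θ : ℝ) : Set R2 := cell (moireMat A q θ)

/-- The disregistry matrix `D_{j → 3-j} = I - A_{3-j} A_j⁻¹`. -/
def disreg (A : Mat2) (q θ : ℝ) (j : Layer) : Mat2 :=
  1 - layerMat A q θ j.other * (layerMat A q θ j)⁻¹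

/-- The square `⟦-N, N⟧²` of integer vectors, which labels the truncated lattice. -/
def box (N : ℕ) : Finset Z2 := Fintype.piFinset fun _ => Finset.Icc (-(N : ℤ)) (N : ℤ)

/-- `θ` is a `(q, K, σ)`-Diophantine 2D rotation. The two matrices below are
`A₁ᵀ A₂^{-T} = q⁻¹ Aᵀ R_θ A^{-T}` and `A₂ᵀ A₁^{-T} = q Aᵀ R_{-θ} A^{-T}`. -/
def IsDiophantineRotation (A : Mat2) (q θ K σ : ℝ) : Prop :=
  0 < K ∧ 0 < σ ∧ ∀ n : Z2, n ≠ 0 →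
    K / ‖intVec n‖ ^ (2 * σ) ≤
        Metric.infDist (act (q⁻¹ • (Aᵀ * rot θ * (A⁻¹)ᵀ)) (intVec n)) (range intVec) ∧
      K / ‖intVec n‖ ^ (2 * σ) ≤
        Metric.infDist (act (q • (Aᵀ * rot (-θ) * (A⁻¹)ᵀ)) (intVec n)) (range intVec)

/-! ### Fourier coefficients on the moire cell -/

/-- `f̂(G) = ⨍_{Γ_M} e^{-i G · x} f(x) dx`. -/
def moireFourier (A : Mat2) (q θ : ℝ) (f : R2 → ℝ) (G : R2) : ℂ :=
  ⨍ x in moireCell A q θ, Complex.exp (-(Complex.I * ((inner ℝ G x : ℝ) : ℂ))) * (f x : ℂ)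

/-- The Fourier coefficients of `|∇|^a f`, where `|∇|^a` is the Fourier multiplier `|G|^a`. -/
def moireFourierAbsNabla (A : Mat2) (q θ a : ℝ) (f : R2 → ℝ) (G : R2) : ℂ :=
  ((‖G‖ ^ a : ℝ) : ℂ) * moireFourier A q θ f G

/-- The regularity class for site potentials: `f` is continuous, lies in `L¹(Γ_M)`, and the Fourier
coefficients of `|∇|^a f` are bounded on the moire frequency lattice `B_M ℤ²`. -/
def IsRegularSitePotential (A : Mat2) (q θ a : ℝ) (f : R2 → ℝ) : Prop :=
  Continuous f ∧ IntegrableOn f (moireCell A q θ) ∧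
    BddAbove (range fun m : Z2 =>
      ‖moireFourierAbsNabla A q θ a f (act (moireFreqMat A q θ) (intVec m))‖)

/-! ### Displacements and energies

`𝒜 k` is the finite set of sublattice degrees of freedom of layer `k`, and `τ k` its shift vectors.
A family indexed by `ℛ_k × 𝒜_k` is written as a family indexed by `ℤ² × 𝒜_k`, through
`n ↦ A_k n`. -/

/-- `w` is a continuous function, periodic for the moire lattice, with one `ℝ³`-valued component
for each sublattice index. -/
def IsPerDisplacement {ι : Type*} (A : Mat2) (q θ : ℝ) (w : R2 → ι → R3) : Prop :=
  (∀ α, Continuous fun x => w x α) ∧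
    ∀ (x : R2) (m : Z2) (α : ι), w (x + act (moireMat A q θ) (intVec m)) α = w x α

/-- The relative difference stencil of `w` at `(x, α)` along the lattice of layer `j`. -/
def monoStencil {ι : Type*} (A : Mat2) (q θ : ℝ) (j : Layer) (w : R2 → ι → R3) (x : R2) (α : ι) :
    Z2 × ι → R3 :=
  fun p => w (x + latPt A q θ j p.1) p.2 - w x α

/-- The truncated monolayer energy density `e^{(mono)}_{j,N}`. -/
def monoEnergyTrunc {ι : Type*} [Fintype ι] (A : Mat2) (q θ : ℝ) (j : Layer)
    (V : ι → (Z2 × ι → R3) → ℝ) (w : R2 → ι → R3) (N : ℕ) : ℝ :=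
  1 / (cellArea A q θ j * (2 * N + 1) ^ 2) *
    ∑ α, ∑ n ∈ box N, V α (monoStencil A q θ j w (latPt A q θ j n) α)

/-- The monolayer site potential `Φ^{(mono)}_j`. -/
def monoSite {ι : Type*} [Fintype ι] (A : Mat2) (q θ : ℝ) (j : Layer)
    (V : ι → (Z2 × ι → R3) → ℝ) (w : R2 → ι → R3) (x : R2) : ℝ :=
  1 / cellArea A q θ j * ∑ α, V α (monoStencil A q θ j w x α)

/-- The thermodynamic limit `e^{(mono)}_j` of the monolayer energy density. -/
def monoEnergy {ι : Type*} [Fintype ι] (A : Mat2) (q θ : ℝ) (j : Layer)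
    (V : ι → (Z2 × ι → R3) → ℝ) (w : R2 → ι → R3) : ℝ :=
  ⨍ x in moireCell A q θ, monoSite A q θ j V w x

/-- Invariance of a many-body potential under shifts of the lattice index. -/
def IsTranslationInvariant {ι : Type*} (V : (Z2 × ι → R3) → ℝ) : Prop :=
  ∀ (a : Z2 × ι → R3) (m : Z2), V (fun p => a (p.1 + m, p.2)) = V a

section Inter

variable {𝒜 : Layer → Type*}

/-- Total positions `Y_k(x, α) = x + τ_k^{(α)} + u_k(x, α)`. -/
def totalPos (τ : ∀ k, 𝒜 k → R2) (u : ∀ k, R2 → 𝒜 k → R3) (k : Layer) (x : R2) (α : 𝒜 k) : R3 :=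
  toR3 x + toR3 (τ k α) + u k x α

/-- The truncated interlayer energy density `e^{(inter)}_{j,N}` for zero layer shifts. -/
def interEnergyTrunc [∀ k, Fintype (𝒜 k)] (A : Mat2) (q θ : ℝ) (τ : ∀ k, 𝒜 k → R2) (j : Layer)
    (V : 𝒜 j → (Z2 × 𝒜 j.other → R3) → ℝ) (u : ∀ k, R2 → 𝒜 k → R3) (N : ℕ) : ℝ :=
  1 / (cellArea A q θ j * (2 * N + 1) ^ 2) *
    ∑ n ∈ box N, ∑ α, V α fun p =>
      totalPos τ u j (latPt A q θ j n) α - totalPos τ u j.other (latPt A q θ j.other p.1) p.2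

/-- The stencil `y - R + τ_j - τ_{3-j} + u_j(x) - u_{3-j}(x - y + R)`, with `R` in the lattice of
layer `3 - j`. -/
def interStencil (A : Mat2) (q θ : ℝ) (τ : ∀ k, 𝒜 k → R2) (j : Layer)
    (u : ∀ k, R2 → 𝒜 k → R3) (x y : R2) (α : 𝒜 j) : Z2 × 𝒜 j.other → R3 :=
  fun p => toR3 (y - latPt A q θ j.other p.1 + τ j α - τ j.other p.2) + u j x α -
    u j.other (x - y + latPt A q θ j.other p.1) p.2

/-- The two-variable interlayer site potential `Ψ^{(inter)}_j[u](x, y)`. -/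
def interSiteTwo [∀ k, Fintype (𝒜 k)] (A : Mat2) (q θ : ℝ) (τ : ∀ k, 𝒜 k → R2) (j : Layer)
    (V : 𝒜 j → (Z2 × 𝒜 j.other → R3) → ℝ) (u : ∀ k, R2 → 𝒜 k → R3) (x y : R2) : ℝ :=
  1 / cellArea A q θ j * ∑ α, V α (interStencil A q θ τ j u x y α)

/-- The interlayer site potential `Φ^{(inter)}_j[u](x) = Ψ^{(inter)}_j[u](x, D_{j → 3-j} x)` for
zero layer shifts. -/
def interSite [∀ k, Fintype (𝒜 k)] (A : Mat2) (q θ : ℝ) (τ : ∀ k, 𝒜 k → R2) (j : Layer)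
    (V : 𝒜 j → (Z2 × 𝒜 j.other → R3) → ℝ) (u : ∀ k, R2 → 𝒜 k → R3) (x : R2) : ℝ :=
  interSiteTwo A q θ τ j V u x (act (disreg A q θ j) x)

/-- The thermodynamic limit `e^{(inter)}_j` of the interlayer energy density, for zero layer
shifts. -/
def interEnergy [∀ k, Fintype (𝒜 k)] (A : Mat2) (q θ : ℝ) (τ : ∀ k, 𝒜 k → R2) (j : Layer)
    (V : 𝒜 j → (Z2 × 𝒜 j.other → R3) → ℝ) (u : ∀ k, R2 → 𝒜 k → R3) : ℝ :=
  ⨍ x in moireCell A q θ, interSite A q θ τ j V u x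

/-! ### Pair potentials -/

/-- A family `v_{(α₁, α₂)}`, read with the index of layer `j` first. -/
def pairSwap (v : 𝒜 .one → 𝒜 .two → R3 → ℝ) : (j : Layer) → 𝒜 j → 𝒜 j.other → R3 → ℝ
  | .one, α, β => v α β
  | .two, α, β => v β α

/-- The many-body potential `a ↦ ½ ∑_{R, β} v_{(α, β)}(a_{R, β})` built from pair potentials. -/
def pairPotential (v : 𝒜 .one → 𝒜 .two → R3 → ℝ) (j : Layer) (α : 𝒜 j)
    (a : Z2 × 𝒜 j.other → R3) : ℝ :=
  1 / 2 * ∑' p : Z2 × 𝒜 j.other, pairSwap v j α p.2 (a p)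

/-- `max |τ₁^{(α₁)} - τ₂^{(α₂)}|` over all pairs of sublattice indices. -/
def sublatticeDist (τ : ∀ k, 𝒜 k → R2) : ℝ :=
  ⨆ p : 𝒜 .one × 𝒜 .two, ‖τ .one p.1 - τ .two p.2‖

/-- The sup norm of the vertical component of a displacement. -/
def supZ {ι : Type*} (w : R2 → ι → R3) : ℝ := ⨆ p : R2 × ι, |w p.1 p.2 2|

/-- The half-height `L^z_u` of the slab on which the pair potentials are considered. -/
def slabHeight (τ : ∀ k, 𝒜 k → R2) (u : ∀ k, R2 → 𝒜 k → R3) : ℝ :=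
  sublatticeDist τ + supZ (u .one) + supZ (u .two)

end Inter

/-! ### Weighted Sobolev spaces `W^{k,∞}_s` -/

/-- `g` is the weak partial derivative `∂_{w 0} ⋯ ∂_{w (m-1)} f` on the open set `Ω`. -/
def HasWeakPartial {d m : ℕ} (Ω : Set (EuclideanSpace ℝ (Fin d))) (w : Fin m → Fin d)
    (f g : EuclideanSpace ℝ (Fin d) → ℝ) : Prop :=
  ∀ φ : EuclideanSpace ℝ (Fin d) → ℝ, ContDiff ℝ ∞ φ → HasCompactSupport φ → tsupport φ ⊆ Ω →
    ∫ x in Ω, f x * iteratedFDeriv ℝ m φ x (fun i => EuclideanSpace.single (w i) (1 : ℝ)) =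
      (-1) ^ m * ∫ x in Ω, g x * φ x

/-- `g ∈ L^∞_s(Ω)`: `⟨x⟩^s g` is essentially bounded on `Ω`, where `⟨x⟩ = (1 + |x|²)^{1/2}`. -/
def MemWeightedLInf {d : ℕ} (s : ℝ) (Ω : Set (EuclideanSpace ℝ (Fin d)))
    (g : EuclideanSpace ℝ (Fin d) → ℝ) : Prop :=
  AEStronglyMeasurable g (volume.restrict Ω) ∧
    ∃ M : ℝ, ∀ᵐ x ∂volume.restrict Ω, Real.sqrt (1 + ‖x‖ ^ 2) ^ s * |g x| ≤ M

/-- `f ∈ W^{k,∞}_s(Ω)`, for `Ω` open and `s ≥ 0` (the unweighted space is `s = 0`). -/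
def MemWeightedSobolev {d : ℕ} (k : ℕ) (s : ℝ) (Ω : Set (EuclideanSpace ℝ (Fin d)))
    (f : EuclideanSpace ℝ (Fin d) → ℝ) : Prop :=
  MemWeightedLInf s Ω f ∧
    ∀ m ≤ k, ∀ w : Fin m → Fin d, ∃ g, HasWeakPartial Ω w f g ∧ MemWeightedLInf s Ω g

/-- `v`, continuous on the closed slab, is in `W^{k,∞}_s(ℝ² × [-L, L])`. For `L > 0` the weak
derivatives are taken in the interior of the slab. For `L = 0` the slab is a plane, and the
condition is that the restriction of `v` to it is in `W^{k,∞}_s(ℝ²)`. -/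
def MemSobolevSlab (k : ℕ) (s L : ℝ) (v : R3 → ℝ) : Prop :=
  ContinuousOn v {x | |x 2| ≤ L} ∧
    (0 < L → MemWeightedSobolev k s {x : R3 | |x 2| < L} v) ∧
    (L = 0 → MemWeightedSobolev k s (univ : Set R2) fun x => v (toR3 x))

end

end MoireBilayer

open MoireBilayer

namespace MoireBilayer

open Filter Topology UnitAddTorus
open scoped Convolution

/-! Both truncated energies are averages of one moire-periodic function, the site potential, over
the points A_j n with n in a box. In the interlayer case this holds because D_j A_j n = A_j n -
A_{3-j} n, so the stencil at a lattice point is a relabelling of the true relative positions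
(`interEnergyTrunc_eq`). Periodicity holds because a moire translation moves the disregistry by a
lattice vector of the other layer (`interSite_periodic`).

In moire coordinates A_j n becomes M n, where M = A_M⁻¹ A_j equals the identity minus A_{3-j}⁻¹ A_j,
up to sign. Expanding the function in a Fourier series on the torus, the average of the m-th
character over the box is a product of two geometric sums with phases (Mᵀ m)_i. Modulo integers, Mᵀ
m is up to sign the vector in the Diophantine condition, so one coordinate is at distance at least
κ‖m‖^(-2σ) from the integers (`exists_dist_round_ge`). That sum is at most a constant times
‖m‖^(2σ), and the other is at most 2N+1. If the coefficients are O(‖m‖^(-a)), the total error is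
therefore (2N+1)⁻¹ times a sum of ‖m‖^(2σ-a), which is finite over ℤ² when a - 2σ > 2
(`exists_discrepancy_le`). Many-body potentials have a = 2(σ+s) with s > 1; pair potentials have a =
6 with σ < 2.

For pair potentials the decay a = 6 comes from sixth differences instead of weak derivatives of
compositions. Differences along half a period of a character multiply its coefficient by -2 each
time (`two_pow_mul_norm_mFourierCoeff_le`), so it suffices that sixth differences of the site
potential are O(|h|⁶) on bounded sets. Potentials and displacements are mollified, the chain rule
estimate is applied to the smooth compositions, and the resulting bound passes to the limit because
a difference involves only finitely many point values (`MemSobolevSlab.exists_fwdDiff_comp_bound`).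
The weight of order 2r > 2 makes the bounds summable over the lattice (`pair_lattice_sum`). -/

/-- The projection of the plane onto the unit torus. -/
noncomputable def toTorus (t : Fin 2 → ℝ) : UnitAddTorus (Fin 2) := fun i => (t i : UnitAddCircle)

/-! ### Exponential sums over boxes and the discrepancy estimate. -/

lemma fourier_one_pow_coe (k : ℤ) (x : ℝ) :
    (fourier k (x : UnitAddCircle) : ℂ) = Complex.exp (2 * Real.pi * Complex.I * x) ^ k := by
  rw [fourier_coe_apply, ← Complex.exp_int_mul]
  congr 1
  push_cast
  ring

/-- Telescoping of the Dirichlet kernel; the product form avoids excluding z = 1. -/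
lemma mul_sum_zpow_Icc (z : ℂ) (hz : z ≠ 0) (N : ℕ) :
    (z - 1) * ∑ k ∈ Finset.Icc (-(N : ℤ)) N, z ^ k = z ^ ((N : ℤ) + 1) - z ^ (-(N : ℤ)) := by
  induction N with
  | zero => simp
  | succ N ih =>
    have h : Finset.Icc (-((N + 1 : ℕ) : ℤ)) ((N + 1 : ℕ) : ℤ) =
        insert (-((N : ℤ) + 1)) (insert ((N : ℤ) + 1) (Finset.Icc (-(N : ℤ)) N)) := by
      ext k
      simp only [Finset.mem_insert, Finset.mem_Icc]
      push_cast
      omega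
    rw [h, Finset.sum_insert, Finset.sum_insert, mul_add, mul_add, ih]
    · have h1 : z ^ ((N : ℤ) + 1 + 1) = z ^ ((N : ℤ) + 1) * z := zpow_add_one₀ hz _
      have h2 : z ^ (-(N : ℤ)) = z ^ (-((N : ℤ) + 1)) * z := by
        rw [← zpow_add_one₀ hz]; congr 1; ring
      push_cast
      rw [h1, h2]
      ring
    · simp
    · simp only [Finset.mem_insert, Finset.mem_Icc]
      omega

/-- The chord has length 2|sin π(x - round x)|, and Jordan's inequality |sin y| ≥ 2|y|/π applies
because |x - round x| ≤ 1/2. -/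
lemma four_mul_abs_sub_round_le (x : ℝ) :
    4 * |x - round x| ≤ ‖Complex.exp (2 * Real.pi * Complex.I * x) - 1‖ := by
  have h : Complex.exp (2 * Real.pi * Complex.I * x) =
      Complex.exp (Complex.I * ((2 * Real.pi * (x - round x) : ℝ) : ℂ)) := by
    rw [Complex.exp_eq_exp_iff_exists_int]
    refine ⟨round x, ?_⟩
    push_cast
    ring
  rw [h, Complex.norm_exp_I_mul_ofReal_sub_one, norm_mul, Real.norm_eq_abs, Real.norm_eq_abs,
    abs_two]
  have h1 : |2 * Real.pi * (x - round x) / 2| = Real.pi * |x - round x| := by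
    rw [show 2 * Real.pi * (x - round x) / 2 = Real.pi * (x - round x) by ring, abs_mul,
      abs_of_pos Real.pi_pos]
  have h2 := abs_sub_round x
  have h3 := Real.mul_abs_le_abs_sin (x := 2 * Real.pi * (x - round x) / 2)
    (by rw [h1]; nlinarith [Real.pi_pos])
  rw [h1] at h3
  have h4 : 2 / Real.pi * (Real.pi * |x - round x|) = 2 * |x - round x| := by
    field_simp
  linarith

/-- The telescoped numerator has modulus at most 2 and the denominator at least 4|x - round x|,
uniformly in N. -/
lemma norm_sum_fourier_Icc_le (N : ℕ) (x : ℝ) (hx : 0 < |x - round x|) :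
    ‖∑ k ∈ Finset.Icc (-(N : ℤ)) N, (fourier k (x : UnitAddCircle) : ℂ)‖ ≤
      1 / (2 * |x - round x|) := by
  simp_rw [fourier_one_pow_coe]
  set z := Complex.exp (2 * Real.pi * Complex.I * x) with hz
  have hz0 : z ≠ 0 := Complex.exp_ne_zero _
  have hz1 : ‖z‖ = 1 := by
    rw [hz, show (2 * Real.pi * Complex.I * x : ℂ) = ((2 * Real.pi * x : ℝ) : ℂ) * Complex.I by
      push_cast; ring, Complex.norm_exp_ofReal_mul_I]
  have h1 := congrArg norm (mul_sum_zpow_Icc z hz0 N)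
  rw [norm_mul] at h1
  have h2 : ‖z ^ ((N : ℤ) + 1) - z ^ (-(N : ℤ))‖ ≤ 2 := by
    refine (norm_sub_le _ _).trans ?_
    rw [norm_zpow, norm_zpow, hz1, one_zpow, one_zpow]
    norm_num
  have h3 := four_mul_abs_sub_round_le x
  rw [le_div_iff₀ (by positivity)]
  nlinarith [norm_nonneg (∑ k ∈ Finset.Icc (-(N : ℤ)) N, z ^ k)]

lemma norm_sum_fourier_Icc_le_card (N : ℕ) (x : ℝ) :
    ‖∑ k ∈ Finset.Icc (-(N : ℤ)) N, (fourier k (x : UnitAddCircle) : ℂ)‖ ≤ 2 * N + 1 := by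
  refine (norm_sum_le _ _).trans ?_
  simp only [fourier_apply, Circle.norm_coe, Finset.sum_const, Int.card_Icc, nsmul_eq_mul, mul_one]
  have : ((N : ℤ) + 1 - -(N : ℤ)).toNat = 2 * N + 1 := by omega
  rw [this]
  push_cast
  rfl

lemma mFourier_toTorus (m : Z2) (t : Fin 2 → ℝ) :
    mFourier m (toTorus t) = Complex.exp (2 * Real.pi * Complex.I * ∑ i, (m i : ℂ) * t i) := by
  simp only [mFourier, ContinuousMap.coe_mk, toTorus, fourier_one_pow_coe, Fin.prod_univ_two,
    Fin.sum_univ_two, ← Complex.exp_int_mul, ← Complex.exp_add]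
  congr 1
  ring

/-- The lattice point `M n` for an integer vector `n`. -/
def mulInt (M : Mat2) (n : Z2) : Fin 2 → ℝ := M *ᵥ fun i => (n i : ℝ)

/-- Since m · Mn = Mᵀm · n, the character splits over the coordinates of n, and box sums become
products of one-dimensional sums. -/
lemma mFourier_toTorus_mulInt (M : Mat2) (m n : Z2) :
    mFourier m (toTorus (mulInt M n)) =
      ∏ i, (fourier (n i) ((mulInt Mᵀ m i : ℝ) : UnitAddCircle) : ℂ) := by
  rw [mFourier_toTorus]
  simp only [mulInt, Fin.prod_univ_two, fourier_one_pow_coe, ← Complex.exp_int_mul,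
    ← Complex.exp_add, Matrix.mulVec, dotProduct, Fin.sum_univ_two, Matrix.transpose_apply]
  congr 1
  push_cast
  ring

/-- A distance to ℤ² controls only one coordinate. The other sum is bounded by its number of terms,
which is why the final rate is 1/(2N+1) and not its square. -/
lemma norm_sum_box_mFourier_le (M : Mat2) (m : Z2) (N : ℕ) (i : Fin 2)
    (hi : 0 < |mulInt Mᵀ m i - round (mulInt Mᵀ m i)|) :
    ‖∑ n ∈ box N, mFourier m (toTorus (mulInt M n))‖ ≤
      (2 * N + 1) * (1 / (2 * |mulInt Mᵀ m i - round (mulInt Mᵀ m i)|)) := by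
  simp_rw [mFourier_toTorus_mulInt]
  rw [box, ← Finset.prod_univ_sum (fun _ => Finset.Icc (-(N : ℤ)) (N : ℤ))
    (fun i k => (fourier k ((mulInt Mᵀ m i : ℝ) : UnitAddCircle) : ℂ)), Fin.prod_univ_two, norm_mul]
  have h := norm_sum_fourier_Icc_le N _ hi
  fin_cases i
  · rw [mul_comm (2 * (N : ℝ) + 1)]
    exact mul_le_mul h (norm_sum_fourier_Icc_le_card _ _) (norm_nonneg _) (by positivity)
  · exact mul_le_mul (norm_sum_fourier_Icc_le_card _ _) h (norm_nonneg _) (by positivity)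

lemma card_box (N : ℕ) : ((box N).card : ℝ) = (2 * N + 1) ^ 2 := by
  have : ((N : ℤ) + 1 + (N : ℤ)).toNat = 2 * N + 1 := by omega
  simp [box, Fintype.card_piFinset, this]

lemma summable_norm_rpow_neg {a : ℝ} (ha : 2 < a) : Summable fun m : Z2 => ‖m‖ ^ (-a) :=
  EisensteinSeries.summable_one_div_norm_rpow ha

lemma one_le_norm_Z2 {m : Z2} (hm : m ≠ 0) : 1 ≤ ‖m‖ := by
  obtain ⟨i, hi⟩ := Function.ne_iff.1 hm
  refine le_trans ?_ (norm_le_pi_norm m i)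
  rw [Int.norm_eq_abs]
  exact_mod_cast Int.one_le_abs hi

/-- Averages of a continuous function on the torus over the points `M n`, `n ∈ [-N, N]²`, converge
to its mean with rate `1 / (2 N + 1)`, if its Fourier coefficients decay fast enough with respect to
a Diophantine condition on `Mᵀ`. -/
theorem exists_discrepancy_le (f : C(UnitAddTorus (Fin 2), ℂ)) (M : Mat2) {a b C κ : ℝ}
    (hκ : 0 < κ) (hb : 0 ≤ b) (hab : 2 < a - b)
    (hf : ∀ m : Z2, m ≠ 0 → ‖mFourierCoeff f m‖ ≤ C * ‖m‖ ^ (-a))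
    (hM : ∀ m : Z2, m ≠ 0 → ∃ i, κ * ‖m‖ ^ (-b) ≤ |mulInt Mᵀ m i - round (mulInt Mᵀ m i)|) :
    ∃ C' : ℝ, 0 < C' ∧ ∀ N : ℕ,
      ‖(1 / (2 * N + 1) ^ 2 : ℂ) * ∑ n ∈ box N, f (toTorus (mulInt M n)) - mFourierCoeff f 0‖ ≤
        C' / (2 * N + 1) := by
  have hsum : Summable (mFourierCoeff f) := by
    refine Summable.of_norm_bounded_eventually
      ((summable_norm_rpow_neg (a := a) (by linarith)).mul_left C) ?_
    filter_upwards [(finite_singleton (0 : Z2)).compl_mem_cofinite] with m hm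
    exact hf m hm
  have hg : Summable fun m : Z2 => C / (2 * κ) * ‖m‖ ^ (-(a - b)) :=
    (summable_norm_rpow_neg hab).mul_left _
  -- The absolute value and the added 1 only secure positivity of the constant.
  refine ⟨|∑' m : Z2, C / (2 * κ) * ‖m‖ ^ (-(a - b))| + 1, by positivity, fun N => ?_⟩
  have hN : (0 : ℝ) < 2 * N + 1 := by positivity
  have hNC : (2 * N + 1 : ℂ) ≠ 0 := by exact_mod_cast hN.ne'
  have h1 : HasSum (fun m => (1 / (2 * N + 1) ^ 2 : ℂ) * ∑ n ∈ box N,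
      mFourierCoeff f m • mFourier m (toTorus (mulInt M n)))
      ((1 / (2 * N + 1) ^ 2 : ℂ) * ∑ n ∈ box N, f (toTorus (mulInt M n))) :=
    (hasSum_sum fun n _ => hasSum_mFourier_series_apply_of_summable hsum _).mul_left _
  -- The mean is subtracted as a series supported at m = 0, where it cancels the average of the
  -- constant character exactly.
  have h2 := h1.sub (hasSum_ite_eq (0 : Z2) (mFourierCoeff f 0))
  rw [← h2.tsum_eq]
  have h3 := hg.hasSum.div_const (2 * (N : ℝ) + 1)
  refine (tsum_of_norm_bounded h3 fun m => ?_).trans ?_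
  · rcases eq_or_ne m 0 with rfl | hm
    · have hc : ((box N).card : ℂ) = (2 * N + 1) ^ 2 := by exact_mod_cast card_box N
      have h0 : (1 / (2 * N + 1) ^ 2 : ℂ) * ∑ n ∈ box N,
          mFourierCoeff f 0 • mFourier (0 : Z2) (toTorus (mulInt M n)) - mFourierCoeff f 0 = 0 := by
        simp only [mFourier_zero, ContinuousMap.one_apply, Finset.sum_const, nsmul_eq_mul, hc,
          smul_eq_mul, mul_one]
        field_simp
        ring
      rw [if_pos rfl, h0, norm_zero]
      -- By the convention for zero to a nonzero power the majorant is 0 at m = 0, so exact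
      -- cancellation of that term is needed.
      simp [Real.zero_rpow (show b - a ≠ 0 by linarith)]
    · obtain ⟨i, hi⟩ := hM m hm
      have hm0 : 0 < ‖m‖ := norm_pos_iff.2 hm
      have hp : 0 < κ * ‖m‖ ^ (-b) := by positivity
      rw [if_neg hm, sub_zero, ← Finset.smul_sum, smul_eq_mul, norm_mul, norm_mul]
      have e1 : ‖(1 / (2 * N + 1) ^ 2 : ℂ)‖ = 1 / (2 * (N : ℝ) + 1) ^ 2 := by
        rw [norm_div, norm_one, norm_pow]
        congr 2
        rw [show (2 * N + 1 : ℂ) = ((2 * N + 1 : ℝ) : ℂ) by push_cast; rfl, Complex.norm_real,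
          Real.norm_of_nonneg hN.le]
      have e2 := norm_sum_box_mFourier_le M m N i (hp.trans_le hi)
      have e3 : 1 / (2 * |mulInt Mᵀ m i - round (mulInt Mᵀ m i)|) ≤ 1 / (2 * (κ * ‖m‖ ^ (-b))) := by
        gcongr
      rw [e1]
      calc 1 / (2 * (N : ℝ) + 1) ^ 2 * (‖mFourierCoeff f m‖ *
            ‖∑ n ∈ box N, mFourier m (toTorus (mulInt M n))‖)
          ≤ 1 / (2 * (N : ℝ) + 1) ^ 2 * ((C * ‖m‖ ^ (-a)) *
            ((2 * N + 1) * (1 / (2 * (κ * ‖m‖ ^ (-b)))))) := by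
            gcongr
            · exact (norm_nonneg _).trans (hf m hm)
            · exact hf m hm
            · exact e2.trans (by gcongr)
        _ = C / (2 * κ) * ‖m‖ ^ (-(a - b)) / (2 * N + 1) := by
            rw [show -(a - b) = -a - -b by ring, Real.rpow_sub hm0]
            field_simp
  · gcongr
    linarith [le_abs_self (∑' m : Z2, C / (2 * κ) * ‖m‖ ^ (-(a - b)))]

/-! ### Fourier coefficients of translates and differences. -/

lemma mFourier_apply_add (m : Z2) (x y : UnitAddTorus (Fin 2)) :
    mFourier m (x + y) = mFourier m x * mFourier m y := by
  simp only [mFourier, ContinuousMap.coe_mk, Pi.add_apply, fourier_apply,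
    smul_add, AddCircle.toCircle_add, Circle.coe_mul, Finset.prod_mul_distrib]

lemma mFourierCoeff_comp_add (f : C(UnitAddTorus (Fin 2), ℂ)) (m : Z2) (h : UnitAddTorus (Fin 2)) :
    mFourierCoeff (fun x => f (x + h)) m = mFourier m h * mFourierCoeff f m := by
  -- `mFourierCoeff` integrates against the product of normalized Haar measures; this instance makes
  -- `volume` denote that measure.
  let _ : MeasureSpace UnitAddCircle := ⟨AddCircle.haarAddCircle⟩
  have : Measure.IsAddHaarMeasure (volume : Measure UnitAddCircle) :=
    inferInstanceAs (Measure.IsAddHaarMeasure AddCircle.haarAddCircle)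
  have e : ∀ x : UnitAddTorus (Fin 2), mFourier (-m) x • f (x + h) =
      mFourier m h * (mFourier (-m) (x + h) • f (x + h)) := by
    intro x
    have : mFourier m h * mFourier (-m) h = 1 := by
      rw [← mFourier_add, add_neg_cancel, mFourier_zero]; rfl
    rw [mFourier_apply_add, smul_eq_mul, smul_eq_mul]
    linear_combination (-(mFourier (-m) x * f (x + h))) * this
  unfold mFourierCoeff
  simp_rw [e]
  rw [integral_const_mul]
  congr 1
  exact integral_add_right_eq_self (μ := (volume : Measure (UnitAddTorus (Fin 2))))
    (fun x => mFourier (-m) x • f x) h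

lemma mFourierCoeff_sub (f g : C(UnitAddTorus (Fin 2), ℂ)) (m : Z2) :
    mFourierCoeff (fun x => f x - g x) m = mFourierCoeff f m - mFourierCoeff g m := by
  let _ : MeasureSpace UnitAddCircle := ⟨AddCircle.haarAddCircle⟩
  have : IsProbabilityMeasure (volume : Measure UnitAddCircle) :=
    inferInstanceAs (IsProbabilityMeasure AddCircle.haarAddCircle)
  unfold mFourierCoeff
  simp_rw [smul_sub]
  exact integral_sub
    (((mFourier (-m)).continuous.smul f.continuous).integrable_of_hasCompactSupport
      (HasCompactSupport.of_compactSpace _))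
    (((mFourier (-m)).continuous.smul g.continuous).integrable_of_hasCompactSupport
      (HasCompactSupport.of_compactSpace _))

lemma norm_mFourierCoeff_le (f : UnitAddTorus (Fin 2) → ℂ) (m : Z2) {B : ℝ} (hB : ∀ x, ‖f x‖ ≤ B) :
    ‖mFourierCoeff f m‖ ≤ B := by
  let _ : MeasureSpace UnitAddCircle := ⟨AddCircle.haarAddCircle⟩
  have : IsProbabilityMeasure (volume : Measure UnitAddCircle) :=
    inferInstanceAs (IsProbabilityMeasure AddCircle.haarAddCircle)
  unfold mFourierCoeff
  refine (norm_integral_le_of_norm_le_const (C := B) (Eventually.of_forall fun x => ?_)).trans ?_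
  · rw [norm_smul]
    have := (mFourier (-m)).norm_coe_le_norm x
    rw [mFourier_norm] at this
    calc _ ≤ 1 * ‖f x‖ := by gcongr
      _ ≤ B := by rw [one_mul]; exact hB x
  · simp

/-- Translations are diagonal in the Fourier basis, so each difference contributes one scalar
factor. -/
lemma mFourierCoeff_fwdDiff_iter (m : Z2) (h : UnitAddTorus (Fin 2)) (n : ℕ) :
    ∀ f : C(UnitAddTorus (Fin 2), ℂ),
      mFourierCoeff ((fwdDiff h)^[n] f) m = (mFourier m h - 1) ^ n * mFourierCoeff f m := by
  induction n with
  | zero => simp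
  | succ n ih =>
    intro f
    let g : C(UnitAddTorus (Fin 2), ℂ) := ⟨fun x => f (x + h), by fun_prop⟩
    have e : fwdDiff h f = (g - f : C(UnitAddTorus (Fin 2), ℂ)) := rfl
    rw [Function.iterate_succ_apply, e, ih, show ((g - f : C(UnitAddTorus (Fin 2), ℂ)) :
      UnitAddTorus (Fin 2) → ℂ) = fun x => g x - f x from rfl, mFourierCoeff_sub,
      show (g : UnitAddTorus (Fin 2) → ℂ) = fun x => f (x + h) from rfl, mFourierCoeff_comp_add]
    ring

/-- The decay of Fourier coefficients from iterated differences with step `1 / (2 mᵢ)`. -/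
theorem two_pow_mul_norm_mFourierCoeff_le (f : C(UnitAddTorus (Fin 2), ℂ)) (m : Z2) (i : Fin 2)
    (hi : m i ≠ 0) (n : ℕ) {B : ℝ}
    (hB : ∀ x, ‖(fwdDiff (toTorus (Pi.single i (1 / (2 * (m i : ℝ))))))^[n] f x‖ ≤ B) :
    2 ^ n * ‖mFourierCoeff f m‖ ≤ B := by
  -- The step is half a period of the m-th character in direction i, so each difference multiplies
  -- the coefficient by -2.
  have h1 : mFourier m (toTorus (Pi.single i (1 / (2 * (m i : ℝ))))) = -1 := by
    rw [mFourier_toTorus, ← Complex.exp_pi_mul_I, Finset.sum_eq_single i]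
    · congr 1
      have : (m i : ℂ) ≠ 0 := by exact_mod_cast hi
      rw [Pi.single_eq_same]
      push_cast
      field_simp
    · intro k _ hk
      simp [hk]
    · simp
  have h2 := norm_mFourierCoeff_le _ m hB
  rw [mFourierCoeff_fwdDiff_iter, h1, norm_mul, norm_pow] at h2
  norm_num at h2
  exact h2

/-! ### Plane linear maps and descent of periodic functions to the torus. -/

/-- `act M` as a continuous linear map. -/
noncomputable def actL (M : Mat2) : R2 →L[ℝ] R2 :=
  LinearMap.toContinuousLinearMap (Matrix.toEuclideanLin M)

lemma actL_apply (M : Mat2) (x : R2) : actL M x = act M x := rfl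

lemma det_actL (M : Mat2) : (actL M).det = M.det := by
  rw [actL, ContinuousLinearMap.det, LinearMap.coe_toContinuousLinearMap,
    Matrix.toEuclideanLin_eq_toLin_orthonormal, LinearMap.det_toLin]

lemma act_add (M : Mat2) (x y : R2) : act M (x + y) = act M x + act M y := map_add (actL M) x y

lemma act_neg (M : Mat2) (x : R2) : act M (-x) = -act M x := map_neg (actL M) x

lemma continuous_act (M : Mat2) : Continuous (act M) := (actL M).continuous

lemma act_act (M N : Mat2) (x : R2) : act M (act N x) = act (M * N) x := by
  simp only [act, Matrix.mulVec_mulVec]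

lemma act_one (x : R2) : act 1 x = x := by simp [act]

lemma act_neg_mat (M : Mat2) (x : R2) : act (-M) x = -act M x := by
  simp only [act, Matrix.neg_mulVec, WithLp.toLp_neg]

lemma intVec_add (m n : Z2) : intVec (m + n) = intVec m + intVec n := by
  ext i; simp [intVec]

lemma intVec_neg (m : Z2) : intVec (-m) = -intVec m := by
  ext i; simp [intVec]

lemma injective_act {P : Mat2} (hP : IsUnit P.det) : Function.Injective (act P) := by
  intro x y hxy
  have := congrArg (act P⁻¹) hxy
  rwa [act_act, act_act, Matrix.nonsing_inv_mul _ hP, act_one, act_one] at this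

lemma isOpenQuotientMap_toTorus : IsOpenQuotientMap toTorus :=
  IsOpenQuotientMap.piMap (f := fun (_ : Fin 2) (x : ℝ) => (x : UnitAddCircle))
    fun _ => QuotientAddGroup.isOpenQuotientMap_mk

lemma exists_eq_add_of_toTorus_eq {s t : Fin 2 → ℝ} (h : toTorus s = toTorus t) :
    ∃ m : Z2, s = t + fun i => (m i : ℝ) := by
  have h1 : ∀ i, ∃ n : ℤ, (n : ℝ) = s i - t i := by
    intro i
    have := congrFun h i
    simp only [toTorus] at this
    rw [← sub_eq_zero, ← AddCircle.coe_sub, AddCircle.coe_eq_zero_iff] at this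
    simpa using this
  choose m hm using h1
  exact ⟨m, by ext i; simp [hm]⟩

/-- A continuous function with period lattice `P ℤ²` descends to the torus. -/
lemma exists_torus_lift (P : Mat2) {f : R2 → ℝ} (hf : Continuous f)
    (hper : ∀ (x : R2) (m : Z2), f (x + act P (intVec m)) = f x) :
    ∃ g : C(UnitAddTorus (Fin 2), ℂ), ∀ t, g (toTorus t) = (f (act P (WithLp.toLp 2 t)) : ℂ) := by
  have hc : Continuous fun t : Fin 2 → ℝ => (f (act P (WithLp.toLp 2 t)) : ℂ) :=
    Complex.continuous_ofReal.comp (hf.comp ((continuous_act P).comp (PiLp.continuous_toLp 2 _)))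
  have hq : IsQuotientMap (⟨toTorus, isOpenQuotientMap_toTorus.continuous⟩ : C(_, _)) :=
    isOpenQuotientMap_toTorus.isQuotientMap
  have hfac : Function.FactorsThrough
      (⟨fun t => (f (act P (WithLp.toLp 2 t)) : ℂ), hc⟩ : C(Fin 2 → ℝ, ℂ))
      (⟨toTorus, isOpenQuotientMap_toTorus.continuous⟩ : C(_, _)) := by
    intro s t hst
    obtain ⟨m, rfl⟩ := exists_eq_add_of_toTorus_eq hst
    change (f _ : ℂ) = (f _ : ℂ)
    rw [WithLp.toLp_add, act_add]
    exact congrArg _ (hper _ m)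
  exact ⟨hq.lift ⟨_, hc⟩ hfac, fun t => DFunLike.congr_fun (hq.lift_comp ⟨_, hc⟩ hfac) t⟩

/-- Change of variables by P: the Jacobian |det P| is also the area of the cell, so it cancels in
the average. The cube is closed on the other side, a null change, to match
`mFourierCoeff_eq_integral`. -/
lemma setAverage_cell {E : Type} [NormedAddCommGroup E] [NormedSpace ℝ E] {P : Mat2}
    (hP : IsUnit P.det) (g : R2 → E) :
    ⨍ x in cell P, g x =
      ∫ t in {t : Fin 2 → ℝ | ∀ i, t i ∈ Ioc ((0 : Fin 2 → ℝ) i) ((0 : Fin 2 → ℝ) i + 1)},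
        g (act P (WithLp.toLp 2 t)) := by
  have hS : MeasurableSet {t : R2 | ∀ i, t i ∈ Ico (0 : ℝ) 1} := by
    rw [ofPred_forall]
    exact MeasurableSet.iInter fun i => measurableSet_Ico.preimage (by fun_prop)
  have hpre : ∀ {F : Type _} [NormedAddCommGroup F] [NormedSpace ℝ F] (G : R2 → F),
      ∫ x in {t : R2 | ∀ i, t i ∈ Ico (0 : ℝ) 1}, G x =
      ∫ t in {t : Fin 2 → ℝ | ∀ i, t i ∈ Ioc ((0 : Fin 2 → ℝ) i) ((0 : Fin 2 → ℝ) i + 1)},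
        G (WithLp.toLp 2 t) := by
    intro F _ _ G
    rw [← (PiLp.volume_preserving_toLp (Fin 2)).setIntegral_preimage_emb
      (MeasurableEquiv.toLp 2 (Fin 2 → ℝ)).measurableEmbedding]
    refine setIntegral_congr_set ?_
    have e1 : WithLp.toLp 2 ⁻¹' {t : R2 | ∀ i, t i ∈ Ico (0 : ℝ) 1} =
        Set.pi univ fun i : Fin 2 => Ico ((0 : Fin 2 → ℝ) i) ((1 : Fin 2 → ℝ) i) := by
      ext t; simp
    have e2 : {t : Fin 2 → ℝ | ∀ i, t i ∈ Ioc ((0 : Fin 2 → ℝ) i) ((0 : Fin 2 → ℝ) i + 1)} =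
        Set.pi univ fun i : Fin 2 => Ioc ((0 : Fin 2 → ℝ) i) ((1 : Fin 2 → ℝ) i) := by
      ext t; simp
    rw [e1, e2]
    exact (Measure.univ_pi_Ico_ae_eq_Icc (μ := fun _ : Fin 2 => (volume : Measure ℝ))).trans
      (Measure.univ_pi_Ioc_ae_eq_Icc (μ := fun _ : Fin 2 => (volume : Measure ℝ))).symm
  have himg : ∀ {F : Type _} [NormedAddCommGroup F] [NormedSpace ℝ F] (G : R2 → F),
      ∫ x in cell P, G x =
      |P.det| • ∫ t in {t : Fin 2 → ℝ | ∀ i, t i ∈ Ioc ((0 : Fin 2 → ℝ) i) ((0 : Fin 2 → ℝ) i + 1)},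
        G (act P (WithLp.toLp 2 t)) := by
    intro F _ _ G
    rw [cell, integral_image_eq_integral_abs_det_fderiv_smul volume hS
      (f := act P) (f' := fun _ => actL P)
      (fun x _ => (actL P).hasFDerivAt.hasFDerivWithinAt) ((injective_act hP).injOn), det_actL,
      integral_smul, hpre]
  -- The area comes from the same change of variables applied to the constant 1.
  have hvol : volume.real (cell P) = |P.det| := by
    have h := himg (fun _ => (1 : ℝ))
    rw [setIntegral_const, setIntegral_const] at h
    have e2 : {t : Fin 2 → ℝ | ∀ i, t i ∈ Ioc ((0 : Fin 2 → ℝ) i) ((0 : Fin 2 → ℝ) i + 1)} =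
        Set.pi univ fun i : Fin 2 => Ioc ((0 : Fin 2 → ℝ) i) ((1 : Fin 2 → ℝ) i) := by
      ext t; simp
    have e3 : volume.real (Set.pi univ fun i : Fin 2 =>
        Ioc ((0 : Fin 2 → ℝ) i) ((1 : Fin 2 → ℝ) i)) = 1 := by
      rw [measureReal_def, Real.volume_pi_Ioc]; simp
    rw [e2, e3] at h
    simpa using h
  rw [setAverage_eq, hvol, himg, smul_smul, inv_mul_cancel₀, one_smul]
  exact abs_ne_zero.2 hP.ne_zero

/-! ### The moire lattice -/

lemma det_rot (φ : ℝ) : (rot φ).det = 1 := by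
  rw [rot, Matrix.det_fin_two_of]
  linarith [Real.sin_sq_add_cos_sq φ]

lemma rot_transpose (φ : ℝ) : (rot φ)ᵀ = rot (-φ) := by
  ext i k; fin_cases i <;> fin_cases k <;> simp [rot]

lemma rot_mul (φ ψ : ℝ) : rot φ * rot ψ = rot (φ + ψ) := by
  ext i k
  fin_cases i <;> fin_cases k <;> simp [rot, Matrix.mul_apply, Real.cos_add, Real.sin_add] <;> ring

lemma rot_inv (φ : ℝ) : (rot φ)⁻¹ = rot (-φ) :=
  Matrix.inv_eq_right_inv (by
    rw [rot_mul, add_neg_cancel]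
    ext i k
    fin_cases i <;> fin_cases k <;> simp [rot])

lemma isUnit_det_layerMat {A : Mat2} (hA : IsUnit A.det) {q : ℝ} (hq : 0 < q) (θ : ℝ) (j : Layer) :
    IsUnit (layerMat A q θ j).det := by
  have h1 : q ^ (-(1 / 2) : ℝ) ≠ 0 := (Real.rpow_pos_of_pos hq _).ne'
  have h2 : q ^ (1 / 2 : ℝ) ≠ 0 := (Real.rpow_pos_of_pos hq _).ne'
  have h3 := hA.ne_zero
  cases j <;> simp only [layerMat, Matrix.det_smul, Matrix.det_mul, det_rot, isUnit_iff_ne_zero,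
    one_mul]
  · exact mul_ne_zero (pow_ne_zero _ h1) h3
  · exact mul_ne_zero (pow_ne_zero _ h2) h3

/-- The matrix `A_{3-j}⁻¹ A_j` of one layer in the lattice coordinates of the other. -/
noncomputable def relMat (A : Mat2) (q θ : ℝ) (j : Layer) : Mat2 :=
  (layerMat A q θ j.other)⁻¹ * layerMat A q θ j

lemma smul_inv_of_ne_zero {c : ℝ} (hc : c ≠ 0) {M : Mat2} (hM : IsUnit M.det) :
    (c • M)⁻¹ = c⁻¹ • M⁻¹ := by
  apply Matrix.inv_eq_right_inv
  rw [smul_mul_smul_comm, mul_inv_cancel₀ hc, Matrix.mul_nonsing_inv _ hM, one_smul]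

/-- The two half rotations meet in A⁻¹ R_{-θ/2} R_{-θ/2} A, and transposition reverses the angle.
The result is the first matrix of the Diophantine condition. -/
lemma relMat_transpose_one {A : Mat2} (hA : IsUnit A.det) {q : ℝ} (hq : 0 < q) (θ : ℝ) :
    (relMat A q θ .one)ᵀ = q⁻¹ • (Aᵀ * rot θ * (A⁻¹)ᵀ) := by
  have h2 : q ^ (1 / 2 : ℝ) ≠ 0 := (Real.rpow_pos_of_pos hq _).ne'
  have h3 : (q ^ (1 / 2 : ℝ))⁻¹ * q ^ (-(1 / 2) : ℝ) = q⁻¹ := by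
    rw [← Real.rpow_neg hq.le, ← Real.rpow_add hq, ← Real.rpow_neg_one]; norm_num
  have h4 : IsUnit (rot (θ / 2) * A).det := by rw [Matrix.det_mul, det_rot, one_mul]; exact hA
  simp only [relMat, layerMat, Layer.other]
  rw [smul_inv_of_ne_zero h2 h4, Matrix.mul_inv_rev, rot_inv, smul_mul_smul_comm, h3,
    Matrix.transpose_smul, show A⁻¹ * rot (-(θ / 2)) * (rot (-(θ / 2)) * A) =
      A⁻¹ * (rot (-(θ / 2)) * rot (-(θ / 2))) * A by simp only [Matrix.mul_assoc], rot_mul,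
    Matrix.transpose_mul, Matrix.transpose_mul, rot_transpose, ← Matrix.mul_assoc]
  congr 4
  ring

lemma relMat_transpose_two {A : Mat2} (hA : IsUnit A.det) {q : ℝ} (hq : 0 < q) (θ : ℝ) :
    (relMat A q θ .two)ᵀ = q • (Aᵀ * rot (-θ) * (A⁻¹)ᵀ) := by
  have h2 : q ^ (-(1 / 2) : ℝ) ≠ 0 := (Real.rpow_pos_of_pos hq _).ne'
  have h3 : (q ^ (-(1 / 2) : ℝ))⁻¹ * q ^ (1 / 2 : ℝ) = q := by
    rw [← Real.rpow_neg hq.le, ← Real.rpow_add hq]; norm_num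
  have h4 : IsUnit (rot (-(θ / 2)) * A).det := by rw [Matrix.det_mul, det_rot, one_mul]; exact hA
  simp only [relMat, layerMat, Layer.other]
  rw [smul_inv_of_ne_zero h2 h4, Matrix.mul_inv_rev, rot_inv, smul_mul_smul_comm, h3,
    Matrix.transpose_smul, show A⁻¹ * rot (-(-(θ / 2))) * (rot (θ / 2) * A) =
      A⁻¹ * (rot (θ / 2) * rot (θ / 2)) * A by simp only [Matrix.mul_assoc, neg_neg], rot_mul,
    Matrix.transpose_mul, Matrix.transpose_mul, rot_transpose, ← Matrix.mul_assoc]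
  congr 4
  ring

lemma relMat_transpose_dist {A : Mat2} (hA : IsUnit A.det) {q θ K σ : ℝ} (hq : 0 < q)
    (hdio : IsDiophantineRotation A q θ K σ) (j : Layer) {n : Z2} (hn : n ≠ 0) :
    K / ‖intVec n‖ ^ (2 * σ) ≤
      Metric.infDist (act (relMat A q θ j)ᵀ (intVec n)) (range intVec) := by
  cases j
  · rw [relMat_transpose_one hA hq]; exact (hdio.2.2 n hn).1
  · rw [relMat_transpose_two hA hq]; exact (hdio.2.2 n hn).2

lemma norm_le_norm_intVec (m : Z2) : ‖m‖ ≤ ‖intVec m‖ := by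
  rw [pi_norm_le_iff_of_nonneg (norm_nonneg _)]
  intro i
  have := PiLp.norm_apply_le (intVec m) i
  simpa [intVec, Int.norm_eq_abs] using this

lemma norm_intVec_le (m : Z2) : ‖intVec m‖ ≤ 2 * ‖m‖ := by
  rw [EuclideanSpace.norm_eq, Fin.sum_univ_two]
  have h : ∀ i, ‖(intVec m) i‖ ≤ ‖m‖ := fun i => by
    simpa [intVec, Int.norm_eq_abs] using norm_le_pi_norm m i
  rw [Real.sqrt_le_left (by positivity)]
  nlinarith [h 0, h 1, norm_nonneg ((intVec m) 0), norm_nonneg ((intVec m) 1), norm_nonneg m]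

lemma norm_intVec_pos {n : Z2} (hn : n ≠ 0) : 0 < ‖intVec n‖ :=
  (norm_pos_iff.2 hn).trans_le (norm_le_norm_intVec n)

/-- Nondegeneracy of the moire lattice follows from the Diophantine condition. The determinant of I
- q⁻¹R_θ is |1 - q⁻¹e^{iθ}|²; if it vanished, the relative matrix would be the identity and would
map integer vectors to integer vectors, at distance 0 from ℤ². -/
lemma det_inv_sub_inv_ne_zero {A : Mat2} (hA : IsUnit A.det) {q θ K σ : ℝ} (hq : 0 < q)
    (hdio : IsDiophantineRotation A q θ K σ) :
    IsUnit ((layerMat A q θ .one)⁻¹ - (layerMat A q θ .two)⁻¹).det := by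
  have h1 := isUnit_det_layerMat hA hq θ .one
  have e : (layerMat A q θ .one)⁻¹ - (layerMat A q θ .two)⁻¹ =
      (1 - relMat A q θ .one) * (layerMat A q θ .one)⁻¹ := by
    rw [relMat, sub_mul, one_mul, Matrix.mul_assoc, Matrix.mul_nonsing_inv _ h1, mul_one]; rfl
  rw [e, Matrix.det_mul]
  refine IsUnit.mul ?_ (Matrix.isUnit_nonsing_inv_det _ h1)
  rw [isUnit_iff_ne_zero]
  intro h0
  have hAT : IsUnit (Aᵀ).det := by rwa [Matrix.det_transpose]
  have e2 : (1 - relMat A q θ .one)ᵀ = Aᵀ * (1 - q⁻¹ • rot θ) * (Aᵀ)⁻¹ := by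
    rw [Matrix.transpose_sub, relMat_transpose_one hA hq, Matrix.transpose_one, mul_sub, sub_mul,
      mul_one, Matrix.mul_nonsing_inv _ hAT, Matrix.transpose_nonsing_inv]
    simp
  have e3 : (1 - q⁻¹ • rot θ).det = 0 := by
    have := congrArg Matrix.det e2
    rw [Matrix.det_transpose, h0, Matrix.det_mul, Matrix.det_mul] at this
    have h5 := (Matrix.isUnit_nonsing_inv_det _ hAT).ne_zero
    have h6 := hAT.ne_zero
    exact (mul_eq_zero.1 ((mul_eq_zero.1 this.symm).resolve_right h5)).resolve_left h6
  have e4 : (1 - q⁻¹ * Real.cos θ) ^ 2 + (q⁻¹ * Real.sin θ) ^ 2 = 0 := by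
    rw [← e3, Matrix.det_fin_two]
    simp [rot]
    ring
  have e5 : q⁻¹ * Real.cos θ = 1 := by nlinarith [sq_nonneg (q⁻¹ * Real.sin θ)]
  have e6 : q⁻¹ * Real.sin θ = 0 := by nlinarith [sq_nonneg (1 - q⁻¹ * Real.cos θ)]
  have e7 : q⁻¹ • rot θ = 1 := by
    ext i k
    fin_cases i <;> fin_cases k <;> simp [rot, e5] <;> simpa using e6
  have e8 : (relMat A q θ .one)ᵀ = 1 := by
    rw [e7, sub_self, mul_zero, zero_mul, Matrix.transpose_sub, sub_eq_zero,
      Matrix.transpose_one] at e2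
    exact e2.symm
  let n : Z2 := fun _ => 1
  have hn : n ≠ 0 := fun h => by simpa [n] using congrFun h 0
  have h9 := relMat_transpose_dist hA hq hdio .one hn
  rw [e8, act_one, Metric.infDist_zero_of_mem (mem_range_self n)] at h9
  have : 0 < K / ‖intVec n‖ ^ (2 * σ) :=
    div_pos hdio.1 (Real.rpow_pos_of_pos (norm_intVec_pos hn) _)
  linarith

lemma moireFreqMat_eq (A : Mat2) (q θ : ℝ) : moireFreqMat A q θ =
    (2 * Real.pi) • ((layerMat A q θ .one)⁻¹ - (layerMat A q θ .two)⁻¹)ᵀ := by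
  simp only [moireFreqMat, recip, Matrix.transpose_sub, smul_sub]

lemma two_pi_ne_zero : (2 * Real.pi) ≠ 0 := by positivity

lemma moireMat_eq {A : Mat2} (hA : IsUnit A.det) {q θ K σ : ℝ} (hq : 0 < q)
    (hdio : IsDiophantineRotation A q θ K σ) :
    moireMat A q θ = ((layerMat A q θ .one)⁻¹ - (layerMat A q θ .two)⁻¹)⁻¹ := by
  have h := det_inv_sub_inv_ne_zero hA hq hdio
  rw [moireMat, recip, moireFreqMat_eq, smul_inv_of_ne_zero two_pi_ne_zero
    (by rwa [Matrix.det_transpose]), Matrix.transpose_smul, smul_smul,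
    mul_inv_cancel₀ two_pi_ne_zero, one_smul, Matrix.transpose_nonsing_inv,
    Matrix.transpose_transpose]

lemma isUnit_det_moireMat {A : Mat2} (hA : IsUnit A.det) {q θ K σ : ℝ} (hq : 0 < q)
    (hdio : IsDiophantineRotation A q θ K σ) : IsUnit (moireMat A q θ).det := by
  rw [moireMat_eq hA hq hdio]
  exact Matrix.isUnit_nonsing_inv_det _ (det_inv_sub_inv_ne_zero hA hq hdio)

lemma isUnit_det_moireFreqMat {A : Mat2} (hA : IsUnit A.det) {q θ K σ : ℝ} (hq : 0 < q)
    (hdio : IsDiophantineRotation A q θ K σ) : IsUnit (moireFreqMat A q θ).det := by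
  rw [moireFreqMat_eq, Matrix.det_smul, Matrix.det_transpose]
  exact (IsUnit.mk0 _ (pow_ne_zero _ two_pi_ne_zero)).mul (det_inv_sub_inv_ne_zero hA hq hdio)

/-- The matrix `A_M⁻¹ A_j` of layer `j` in moire coordinates. -/
noncomputable def moireCoordMat (A : Mat2) (q θ : ℝ) : Layer → Mat2
  | .one => 1 - relMat A q θ .one
  | .two => relMat A q θ .two - 1

/-- Since A_M⁻¹ = A₁⁻¹ - A₂⁻¹, multiplication by A_j on the right leaves the identity in one term,
with opposite signs for the two layers. -/
lemma moireMat_mul_moireCoordMat {A : Mat2} (hA : IsUnit A.det) {q θ K σ : ℝ} (hq : 0 < q)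
    (hdio : IsDiophantineRotation A q θ K σ) (j : Layer) :
    moireMat A q θ * moireCoordMat A q θ j = layerMat A q θ j := by
  have h := det_inv_sub_inv_ne_zero hA hq hdio
  have e : moireCoordMat A q θ j =
      ((layerMat A q θ .one)⁻¹ - (layerMat A q θ .two)⁻¹) * layerMat A q θ j := by
    cases j
    · rw [sub_mul, Matrix.nonsing_inv_mul _ (isUnit_det_layerMat hA hq θ .one)]; rfl
    · rw [sub_mul, Matrix.nonsing_inv_mul _ (isUnit_det_layerMat hA hq θ .two)]; rfl
  rw [moireMat_eq hA hq hdio, e, ← Matrix.mul_assoc, Matrix.nonsing_inv_mul _ h, one_mul]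

lemma latPt_eq_act_moireMat {A : Mat2} (hA : IsUnit A.det) {q θ K σ : ℝ} (hq : 0 < q)
    (hdio : IsDiophantineRotation A q θ K σ) (j : Layer) (n : Z2) :
    latPt A q θ j n =
      act (moireMat A q θ) (WithLp.toLp 2 (mulInt (moireCoordMat A q θ j) n)) := by
  rw [latPt, ← moireMat_mul_moireCoordMat hA hq hdio j, ← act_act]
  rfl

/-- A moire translation acts on the disregistry as a lattice translation of the other layer. -/
lemma act_disreg_moire {A : Mat2} (hA : IsUnit A.det) {q θ K σ : ℝ} (hq : 0 < q)
    (hdio : IsDiophantineRotation A q θ K σ) (j : Layer) (m : Z2) :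
    ∃ m' : Z2, act (disreg A q θ j) (act (moireMat A q θ) (intVec m)) =
      latPt A q θ j.other m' := by
  have h := det_inv_sub_inv_ne_zero hA hq hdio
  have h1 := isUnit_det_layerMat hA hq θ .one
  have h2 := isUnit_det_layerMat hA hq θ .two
  have e3 := Matrix.mul_nonsing_inv _ h
  rw [← moireMat_eq hA hq hdio] at e3
  cases j
  -- The sign differs between layers because D₁ = -A₂ A_M⁻¹ and D₂ = A₁ A_M⁻¹.
  · refine ⟨-m, ?_⟩
    have e : disreg A q θ .one = -(layerMat A q θ .two *
        ((layerMat A q θ .one)⁻¹ - (layerMat A q θ .two)⁻¹)) := by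
      rw [mul_sub, Matrix.mul_nonsing_inv _ h2, disreg, neg_sub]; rfl
    rw [act_act, e, neg_mul, Matrix.mul_assoc, e3, mul_one, act_neg_mat, latPt, intVec_neg, act_neg]
    rfl
  · refine ⟨m, ?_⟩
    have e : disreg A q θ .two = layerMat A q θ .one *
        ((layerMat A q θ .one)⁻¹ - (layerMat A q θ .two)⁻¹) := by
      rw [mul_sub, Matrix.mul_nonsing_inv _ h1, disreg]; rfl
    rw [act_act, e, Matrix.mul_assoc, e3, mul_one]
    rfl

/-! ### From the Diophantine condition to averages over layer lattices. -/

/-- The vector equals the Diophantine one up to sign and an integer shift, so both are equally far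
from ℤ². The Euclidean distance is at most the sum of the two coordinate distances, so one of them
carries half; this gives the factor 2. The factor 2^(2σ) comes from comparing Euclidean and sup
norms. -/
lemma exists_dist_round_ge {A : Mat2} (hA : IsUnit A.det) {q θ K σ : ℝ} (hq : 0 < q)
    (hdio : IsDiophantineRotation A q θ K σ) (j : Layer) {m : Z2} (hm : m ≠ 0) :
    ∃ i, K / (2 * 2 ^ (2 * σ)) * ‖m‖ ^ (-(2 * σ)) ≤
      |mulInt (moireCoordMat A q θ j)ᵀ m i - round (mulInt (moireCoordMat A q θ j)ᵀ m i)| := by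
  have h1 := relMat_transpose_dist hA hq hdio j hm
  set y := act (relMat A q θ j)ᵀ (intVec m) with hy
  set w := mulInt (moireCoordMat A q θ j)ᵀ m with hw
  have hm0 : 0 < ‖m‖ := norm_pos_iff.2 hm
  have hd : Metric.infDist y (range intVec) ≤ |w 0 - round (w 0)| + |w 1 - round (w 1)| := by
    obtain ⟨k, hk⟩ : ∃ k : Z2, ‖y - intVec k‖ = ‖WithLp.toLp 2 (fun i => w i - round (w i))‖ := by
      cases j
      · have e : ∀ i, w i = m i - y i := by
          simp only [hw, hy, mulInt, moireCoordMat, Matrix.transpose_sub, Matrix.transpose_one,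
            Matrix.sub_mulVec, Matrix.one_mulVec]
          exact fun i => rfl
        refine ⟨m - fun i => round (w i), ?_⟩
        rw [← norm_neg]
        congr 1
        ext i
        simp only [PiLp.neg_apply, PiLp.sub_apply, intVec, Pi.sub_apply, Int.cast_sub]
        linarith [e i]
      · have e : ∀ i, w i = y i - m i := by
          simp only [hw, hy, mulInt, moireCoordMat, Matrix.transpose_sub, Matrix.transpose_one,
            Matrix.sub_mulVec, Matrix.one_mulVec]
          exact fun i => rfl
        refine ⟨m + fun i => round (w i), ?_⟩
        congr 1
        ext i
        simp only [PiLp.sub_apply, intVec, Pi.add_apply, Int.cast_add]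
        linarith [e i]
    refine (Metric.infDist_le_dist_of_mem (mem_range_self k)).trans ?_
    rw [dist_eq_norm, hk, EuclideanSpace.norm_eq, Fin.sum_univ_two,
      Real.sqrt_le_left (by positivity)]
    simp only [Real.norm_eq_abs]
    nlinarith [abs_nonneg (w 0 - round (w 0)), abs_nonneg (w 1 - round (w 1))]
  have hK : K / (2 * 2 ^ (2 * σ)) * ‖m‖ ^ (-(2 * σ)) * 2 ≤ K / ‖intVec m‖ ^ (2 * σ) := by
    have e : K / (2 * 2 ^ (2 * σ)) * ‖m‖ ^ (-(2 * σ)) * 2 = K / (2 * ‖m‖) ^ (2 * σ) := by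
      rw [Real.mul_rpow zero_le_two hm0.le, Real.rpow_neg hm0.le]
      field_simp
    rw [e]
    have := hdio.1.le
    have := hdio.2.1.le
    have := norm_intVec_pos hm
    gcongr
    exact norm_intVec_le m
  by_contra hcon
  push Not at hcon
  linarith [hcon 0, hcon 1]

/-- The duality A_Mᵀ B_M = 2πI identifies moire plane waves with the standard characters of the
torus. -/
lemma inner_moire {A : Mat2} (hA : IsUnit A.det) {q θ K σ : ℝ} (hq : 0 < q)
    (hdio : IsDiophantineRotation A q θ K σ) (m : Z2) (t : Fin 2 → ℝ) :
    inner ℝ (act (moireFreqMat A q θ) (intVec m)) (act (moireMat A q θ) (WithLp.toLp 2 t)) =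
      2 * Real.pi * ∑ i, (m i : ℝ) * t i := by
  have hB := isUnit_det_moireFreqMat hA hq hdio
  have e : (moireMat A q θ)ᵀ * moireFreqMat A q θ = (2 * Real.pi) • (1 : Mat2) := by
    rw [moireMat, recip, Matrix.transpose_smul, Matrix.transpose_transpose, Matrix.smul_mul,
      Matrix.nonsing_inv_mul _ hB]
  rw [EuclideanSpace.inner_eq_star_dotProduct]
  simp only [act, star_trivial]
  rw [dotProduct_comm, Matrix.dotProduct_mulVec, ← Matrix.mulVec_transpose, Matrix.mulVec_mulVec, e,
    Matrix.smul_mulVec, Matrix.one_mulVec, smul_dotProduct]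
  simp [dotProduct, intVec]

lemma moireFourier_eq_mFourierCoeff {A : Mat2} (hA : IsUnit A.det) {q θ K σ : ℝ} (hq : 0 < q)
    (hdio : IsDiophantineRotation A q θ K σ) {f : R2 → ℝ} {g : C(UnitAddTorus (Fin 2), ℂ)}
    (hg : ∀ t, g (toTorus t) = (f (act (moireMat A q θ) (WithLp.toLp 2 t)) : ℂ)) (m : Z2) :
    moireFourier A q θ f (act (moireFreqMat A q θ) (intVec m)) = mFourierCoeff g m := by
  rw [moireFourier, moireCell, setAverage_cell (isUnit_det_moireMat hA hq hdio),
    mFourierCoeff_eq_integral g m 0]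
  congr 1
  ext t
  have h1 : mFourier (-m) (fun i => (t i : UnitAddCircle)) = _ := mFourier_toTorus (-m) t
  have h2 : g (fun i => (t i : UnitAddCircle)) = _ := hg t
  rw [h1, h2, inner_moire hA hq hdio, smul_eq_mul]
  congr 2
  push_cast
  simp only [Pi.neg_apply, Int.cast_neg, neg_mul, Finset.sum_neg_distrib, mul_neg]
  ring

lemma setAverage_moireCell_eq_mFourierCoeff {A : Mat2} (hA : IsUnit A.det) {q θ K σ : ℝ}
    (hq : 0 < q) (hdio : IsDiophantineRotation A q θ K σ) {f : R2 → ℝ}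
    {g : C(UnitAddTorus (Fin 2), ℂ)}
    (hg : ∀ t, g (toTorus t) = (f (act (moireMat A q θ) (WithLp.toLp 2 t)) : ℂ)) :
    ((⨍ x in moireCell A q θ, f x : ℝ) : ℂ) = mFourierCoeff g 0 := by
  rw [moireCell, setAverage_cell (isUnit_det_moireMat hA hq hdio), mFourierCoeff_eq_integral g 0 0,
    ← integral_complex_ofReal]
  congr 1
  ext t
  have h2 : g (fun i => (t i : UnitAddCircle)) = _ := hg t
  rw [h2, neg_zero, mFourier_zero]
  simp

/-- Averages of a moire-periodic function over the truncated lattice of a layer converge to its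
mean over the moire cell, given decay of its Fourier coefficients. -/
theorem exists_lattice_average_sub_le {A : Mat2} (hA : IsUnit A.det) {q θ K σ : ℝ} (hq : 0 < q)
    (hdio : IsDiophantineRotation A q θ K σ) (j : Layer) {f : R2 → ℝ}
    {g : C(UnitAddTorus (Fin 2), ℂ)}
    (hg : ∀ t, g (toTorus t) = (f (act (moireMat A q θ) (WithLp.toLp 2 t)) : ℂ))
    {a C : ℝ} (ha : 2 < a - 2 * σ)
    (hC : ∀ m : Z2, m ≠ 0 → ‖mFourierCoeff g m‖ ≤ C * ‖m‖ ^ (-a)) :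
    ∃ C' : ℝ, 0 < C' ∧ ∀ N : ℕ,
      |1 / (2 * (N : ℝ) + 1) ^ 2 * ∑ n ∈ box N, f (latPt A q θ j n) -
        ⨍ x in moireCell A q θ, f x| ≤ C' / (2 * N + 1) := by
  have hK := hdio.1
  obtain ⟨C', hC', h⟩ := exists_discrepancy_le g (moireCoordMat A q θ j) (a := a) (b := 2 * σ)
    (κ := K / (2 * 2 ^ (2 * σ))) (by positivity) (by linarith [hdio.2.1]) ha hC
    (fun m hm => exists_dist_round_ge hA hq hdio j hm)
  refine ⟨C', hC', fun N => ?_⟩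
  refine le_trans (le_of_eq ?_) (h N)
  rw [← setAverage_moireCell_eq_mFourierCoeff hA hq hdio hg]
  simp_rw [hg, ← latPt_eq_act_moireMat hA hq hdio]
  rw [← Real.norm_eq_abs, ← Complex.norm_real]
  push_cast
  rfl

lemma mul_norm_le_norm_act {P : Mat2} (hP : IsUnit P.det) :
    ∃ c : ℝ, 0 < c ∧ ∀ m : Z2, c * ‖m‖ ≤ ‖act P (intVec m)‖ := by
  refine ⟨(‖actL P⁻¹‖ + 1)⁻¹, by positivity, fun m => ?_⟩
  have h1 : act P⁻¹ (act P (intVec m)) = intVec m := by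
    rw [act_act, Matrix.nonsing_inv_mul _ hP, act_one]
  have h2 := (actL P⁻¹).le_opNorm (act P (intVec m))
  rw [actL_apply, h1] at h2
  rw [inv_mul_le_iff₀ (by positivity)]
  nlinarith [norm_le_norm_intVec m, norm_nonneg (act P (intVec m))]

/-- Invertibility of B_M gives |B_M m| ≥ c‖m‖, so the bound on |G|^(2(σ+s)) f̂(G) is decay in m. The
surplus over the small divisors is 2(σ+s) - 2σ = 2s > 2. -/
theorem exists_lattice_average_sub_le_of_regular {A : Mat2} (hA : IsUnit A.det) {q θ K σ : ℝ}
    (hq : 0 < q) (hdio : IsDiophantineRotation A q θ K σ) (j : Layer) {f : R2 → ℝ}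
    (hper : ∀ (x : R2) (m : Z2), f (x + act (moireMat A q θ) (intVec m)) = f x)
    {s : ℝ} (hs : 1 < s) (hf : IsRegularSitePotential A q θ (2 * (σ + s)) f) :
    ∃ C : ℝ, 0 < C ∧ ∀ N : ℕ,
      |1 / (2 * (N : ℝ) + 1) ^ 2 * ∑ n ∈ box N, f (latPt A q θ j n) -
        ⨍ x in moireCell A q θ, f x| ≤ C / (2 * N + 1) := by
  obtain ⟨g, hg⟩ := exists_torus_lift _ hf.1 hper
  obtain ⟨C, hC⟩ := hf.2.2
  obtain ⟨c, hc, hcm⟩ := mul_norm_le_norm_act (isUnit_det_moireFreqMat hA hq hdio)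
  have hσ := hdio.2.1
  refine exists_lattice_average_sub_le hA hq hdio j hg (a := 2 * (σ + s))
    (C := C * c ^ (-(2 * (σ + s))))
    (by linarith) fun m hm => ?_
  have h1 := hC (mem_range_self m)
  simp only [moireFourierAbsNabla, norm_mul, Complex.norm_real, Real.norm_eq_abs] at h1
  rw [moireFourier_eq_mFourierCoeff hA hq hdio hg, abs_of_nonneg (by positivity)] at h1
  have hm0 : 0 < ‖m‖ := norm_pos_iff.2 hm
  have h2 : (c * ‖m‖) ^ (2 * (σ + s)) * ‖mFourierCoeff g m‖ ≤ C := by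
    refine le_trans ?_ h1
    gcongr
    exact hcm m
  have h3 : C * c ^ (-(2 * (σ + s))) * ‖m‖ ^ (-(2 * (σ + s))) = C / (c * ‖m‖) ^ (2 * (σ + s)) := by
    rw [mul_assoc, ← Real.mul_rpow hc.le hm0.le, Real.rpow_neg (by positivity), div_eq_mul_inv]
  rw [h3, le_div_iff₀ (by positivity), mul_comm]
  exact h2

/-! ### Site potentials: periodicity and energies as lattice averages. -/

lemma monoSite_periodic {ι : Type*} [Fintype ι] {A : Mat2} {q θ : ℝ} (j : Layer)
    (V : ι → (Z2 × ι → R3) → ℝ) {w : R2 → ι → R3} (hw : IsPerDisplacement A q θ w)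
    (x : R2) (m : Z2) :
    monoSite A q θ j V w (x + act (moireMat A q θ) (intVec m)) = monoSite A q θ j V w x := by
  simp only [monoSite]
  congr 1
  refine Finset.sum_congr rfl fun α _ => ?_
  congr 1
  ext p : 1
  simp only [monoStencil]
  rw [add_right_comm, hw.2, hw.2]

lemma monoEnergyTrunc_eq {ι : Type*} [Fintype ι] (A : Mat2) (q θ : ℝ) (j : Layer)
    (V : ι → (Z2 × ι → R3) → ℝ) (w : R2 → ι → R3) (N : ℕ) :
    monoEnergyTrunc A q θ j V w N =
      1 / (2 * (N : ℝ) + 1) ^ 2 * ∑ n ∈ box N, monoSite A q θ j V w (latPt A q θ j n) := by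
  simp only [monoEnergyTrunc, monoSite]
  rw [← Finset.mul_sum, Finset.sum_comm, one_div_mul_eq_div, one_div_mul_eq_div,
    one_div_mul_eq_div, div_div]

section Inter

variable {𝒜 : Layer → Type*}

/-- The shift of the disregistry by a lattice vector of the other layer is absorbed into the
summation label. The arguments of the displacements then change only by the moire vector, which
periodicity removes. One shift serves all sublattice indices. -/
lemma interStencil_moire {A : Mat2} (hA : IsUnit A.det) {q θ K σ : ℝ} (hq : 0 < q)
    (hdio : IsDiophantineRotation A q θ K σ) (τ : ∀ k, 𝒜 k → R2) (j : Layer)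
    {u : ∀ k, R2 → 𝒜 k → R3} (hu : ∀ k, IsPerDisplacement A q θ (u k)) (x : R2) (m : Z2) :
    ∃ m' : Z2, ∀ α, interStencil A q θ τ j u (x + act (moireMat A q θ) (intVec m))
      (act (disreg A q θ j) (x + act (moireMat A q θ) (intVec m))) α = fun p =>
      interStencil A q θ τ j u x (act (disreg A q θ j) x) α (p.1 + m', p.2) := by
  obtain ⟨m', hm'⟩ := act_disreg_moire hA hq hdio j m
  refine ⟨-m', fun α => ?_⟩
  ext p : 1
  simp only [interStencil]
  have e : latPt A q θ j.other (p.1 + -m') = latPt A q θ j.other p.1 - latPt A q θ j.other m' := by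
    simp only [latPt]
    rw [intVec_add, intVec_neg, act_add, act_neg, sub_eq_add_neg]
  rw [act_add, hm', e, (hu j).2, ← (hu j.other).2 (x - act (disreg A q θ j) x + _) m]
  have e1 : act (disreg A q θ j) x + latPt A q θ j.other m' - latPt A q θ j.other p.1 + τ j α -
      τ j.other p.2 = act (disreg A q θ j) x -
        (latPt A q θ j.other p.1 - latPt A q θ j.other m') + τ j α - τ j.other p.2 := by abel
  have e2 : x + act (moireMat A q θ) (intVec m) - (act (disreg A q θ j) x +
      latPt A q θ j.other m') + latPt A q θ j.other p.1 = x - act (disreg A q θ j) x +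
        (latPt A q θ j.other p.1 - latPt A q θ j.other m') + act (moireMat A q θ) (intVec m) := by
    abel
  rw [e1, e2]

lemma interSite_periodic [∀ k, Fintype (𝒜 k)] {A : Mat2} (hA : IsUnit A.det) {q θ K σ : ℝ}
    (hq : 0 < q) (hdio : IsDiophantineRotation A q θ K σ) (τ : ∀ k, 𝒜 k → R2) (j : Layer)
    {V : 𝒜 j → (Z2 × 𝒜 j.other → R3) → ℝ} (hV : ∀ α, IsTranslationInvariant (V α))
    {u : ∀ k, R2 → 𝒜 k → R3} (hu : ∀ k, IsPerDisplacement A q θ (u k)) (x : R2) (m : Z2) :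
    interSite A q θ τ j V u (x + act (moireMat A q θ) (intVec m)) = interSite A q θ τ j V u x := by
  obtain ⟨m', hm'⟩ := interStencil_moire hA hq hdio τ j hu x m
  simp only [interSite, interSiteTwo]
  congr 1
  refine Finset.sum_congr rfl fun α _ => ?_
  rw [hm', hV α]

lemma toR3_add (x y : R2) : toR3 (x + y) = toR3 x + toR3 y := by
  ext i; fin_cases i <;> simp [toR3]

lemma toR3_sub (x y : R2) : toR3 (x - y) = toR3 x - toR3 y := by
  ext i; fin_cases i <;> simp [toR3]

lemma act_disreg_latPt {A : Mat2} (hA : IsUnit A.det) {q : ℝ} (hq : 0 < q) (θ : ℝ) (j : Layer)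
    (n : Z2) :
    act (disreg A q θ j) (latPt A q θ j n) = latPt A q θ j n - latPt A q θ j.other n := by
  have h := isUnit_det_layerMat hA hq θ j
  rw [latPt, act_act, disreg, sub_mul, one_mul, Matrix.mul_assoc, Matrix.nonsing_inv_mul _ h,
    mul_one, sub_eq_add_neg, latPt, sub_eq_add_neg, ← act_neg_mat]
  simp only [act, Matrix.add_mulVec, WithLp.toLp_add]

/-- At the lattice point with label n the disregistry is A_j n - A_{3-j} n, so the stencil labels
the other layer relative to its point n. Translation invariance moves the label by n. -/
lemma interEnergyTrunc_eq [∀ k, Fintype (𝒜 k)] {A : Mat2} (hA : IsUnit A.det) {q : ℝ} (hq : 0 < q)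
    (θ : ℝ) (τ : ∀ k, 𝒜 k → R2) (j : Layer) {V : 𝒜 j → (Z2 × 𝒜 j.other → R3) → ℝ}
    (hV : ∀ α, IsTranslationInvariant (V α)) (u : ∀ k, R2 → 𝒜 k → R3) (N : ℕ) :
    interEnergyTrunc A q θ τ j V u N =
      1 / (2 * (N : ℝ) + 1) ^ 2 * ∑ n ∈ box N, interSite A q θ τ j V u (latPt A q θ j n) := by
  simp only [interEnergyTrunc, interSite, interSiteTwo]
  rw [← Finset.mul_sum, one_div_mul_eq_div, one_div_mul_eq_div, one_div_mul_eq_div, div_div]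
  congr 1
  refine Finset.sum_congr rfl fun n _ => Finset.sum_congr rfl fun α _ => ?_
  rw [← hV α _ n]
  congr 1
  ext p : 1
  have e : latPt A q θ j.other (p.1 + n) = latPt A q θ j.other p.1 + latPt A q θ j.other n := by
    simp only [latPt]
    rw [intVec_add, act_add]
  simp only [interStencil, totalPos]
  rw [act_disreg_latPt hA hq, e]
  have e2 : latPt A q θ j n - (latPt A q θ j n - latPt A q θ j.other n) + latPt A q θ j.other p.1 =
      latPt A q θ j.other p.1 + latPt A q θ j.other n := by abel
  rw [e2]
  simp only [toR3_add, toR3_sub]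
  abel

end Inter

/-! ### Mollification -/

section Mollify

variable {d : ℕ}

/-- The Japanese bracket `⟨x⟩ = (1 + |x|²)^{1/2}`. -/
noncomputable def jap {E : Type*} [NormedAddCommGroup E] (x : E) : ℝ := Real.sqrt (1 + ‖x‖ ^ 2)

lemma one_le_jap {E : Type*} [NormedAddCommGroup E] (x : E) : 1 ≤ jap x := by
  rw [jap, Real.one_le_sqrt]; nlinarith [sq_nonneg ‖x‖]

lemma jap_pos {E : Type*} [NormedAddCommGroup E] (x : E) : 0 < jap x :=
  zero_lt_one.trans_le (one_le_jap x)

/-- Weights are comparable at distance at most 1, which bounds the radius of every mollifier in use.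
-/
lemma jap_le_two_mul {E : Type*} [NormedAddCommGroup E] {x y : E} (h : ‖x - y‖ ≤ 1) :
    jap x ≤ 2 * jap y := by
  rw [jap, jap, Real.sqrt_le_left (by positivity), mul_pow, Real.sq_sqrt (by positivity)]
  have : ‖x‖ ≤ ‖y‖ + 1 := by
    have := norm_sub_norm_le x y
    linarith
  nlinarith [sq_nonneg (‖y‖ - 1), norm_nonneg x, norm_nonneg y]

/-- A sequence of bump functions at the origin with shrinking support. -/
noncomputable def bump (d : ℕ) (n : ℕ) : ContDiffBump (0 : EuclideanSpace ℝ (Fin d)) where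
  rIn := 1 / (2 * ((n : ℝ) + 1))
  rOut := 1 / ((n : ℝ) + 1)
  rIn_pos := by positivity
  rIn_lt_rOut := by
    apply one_div_lt_one_div_of_lt <;> linarith [(n.cast_nonneg : (0 : ℝ) ≤ n)]

lemma bump_rOut (n : ℕ) : (bump d n).rOut = 1 / ((n : ℝ) + 1) := rfl

/-- Mollification, at scale `1 / (n + 1)`, of `f` restricted to `Ω`. -/
noncomputable def mollify (Ω : Set (EuclideanSpace ℝ (Fin d)))
    (f : EuclideanSpace ℝ (Fin d) → ℝ) (n : ℕ) : EuclideanSpace ℝ (Fin d) → ℝ :=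
  (bump d n).normed volume ⋆[ContinuousLinearMap.lsmul ℝ ℝ, volume] Ω.indicator f

variable {Ω : Set (EuclideanSpace ℝ (Fin d))} {f : EuclideanSpace ℝ (Fin d) → ℝ}

lemma MemWeightedLInf.locallyIntegrable {s : ℝ} (hs : 0 ≤ s) (hΩ : MeasurableSet Ω)
    (hf : MemWeightedLInf s Ω f) : LocallyIntegrable (Ω.indicator f) := by
  obtain ⟨h1, M, hM⟩ := hf
  have h2 : MemLp f ⊤ (volume.restrict Ω) := by
    refine memLp_top_of_bound h1 M ?_
    filter_upwards [hM] with x hx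
    have : 1 ≤ Real.sqrt (1 + ‖x‖ ^ 2) ^ s := Real.one_le_rpow (one_le_jap x) hs
    rw [Real.norm_eq_abs]
    nlinarith [abs_nonneg (f x)]
  exact ((memLp_indicator_iff_restrict hΩ).2 h2).locallyIntegrable le_top

lemma contDiff_mollify (hf : LocallyIntegrable (Ω.indicator f)) (n : ℕ) :
    ContDiff ℝ ∞ (mollify Ω f n) :=
  (bump d n).hasCompactSupport_normed.contDiff_convolution_left _ (bump d n).contDiff_normed hf

lemma mollify_apply (hΩ : MeasurableSet Ω) (n : ℕ) (x : EuclideanSpace ℝ (Fin d)) :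
    mollify Ω f n x = ∫ t in Ω, (bump d n).normed volume (x - t) * f t := by
  rw [mollify, convolution_lsmul_swap, ← integral_indicator hΩ]
  congr 1
  ext t
  by_cases ht : t ∈ Ω <;> simp [ht]

lemma hasCompactSupport_iteratedFDeriv_apply {φ : EuclideanSpace ℝ (Fin d) → ℝ}
    (hc : HasCompactSupport φ) (m : ℕ) (v : Fin m → EuclideanSpace ℝ (Fin d)) :
    HasCompactSupport fun x => iteratedFDeriv ℝ m φ x v :=
  (hc.iteratedFDeriv (𝕜 := ℝ) m).comp_left
    (g := fun T : EuclideanSpace ℝ (Fin d) [×m]→L[ℝ] ℝ => T v) rfl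

lemma contDiff_iteratedFDeriv_apply {φ : EuclideanSpace ℝ (Fin d) → ℝ} (hφ : ContDiff ℝ ∞ φ)
    (m : ℕ) (v : Fin m → EuclideanSpace ℝ (Fin d)) :
    ContDiff ℝ ∞ fun x => iteratedFDeriv ℝ m φ x v := by
  have h : ContDiff ℝ ∞ (iteratedFDeriv ℝ m φ) :=
    hφ.iteratedFDeriv_right (by exact_mod_cast le_top)
  exact (ContinuousMultilinearMap.apply ℝ (fun _ : Fin m => EuclideanSpace ℝ (Fin d)) ℝ
    v).contDiff.comp h

/-- Derivatives of a convolution with a test function fall on the test function. -/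
lemma iteratedFDeriv_convolution_apply {φ F : EuclideanSpace ℝ (Fin d) → ℝ}
    (hc : HasCompactSupport φ) (hφ : ContDiff ℝ ∞ φ) (hF : LocallyIntegrable F) (m : ℕ) :
    ∀ (v : Fin m → EuclideanSpace ℝ (Fin d)) (x : EuclideanSpace ℝ (Fin d)),
    iteratedFDeriv ℝ m (φ ⋆[ContinuousLinearMap.lsmul ℝ ℝ, volume] F) x v =
      ((fun y => iteratedFDeriv ℝ m φ y v) ⋆[ContinuousLinearMap.lsmul ℝ ℝ, volume] F) x := by
  induction m with
  | zero => intro v x; simp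
  | succ m ih =>
    intro v x
    have hconv : ContDiff ℝ ∞ (φ ⋆[ContinuousLinearMap.lsmul ℝ ℝ, volume] F) :=
      hc.contDiff_convolution_left _ hφ hF
    have key : ∀ (G : EuclideanSpace ℝ (Fin d) → ℝ), ContDiff ℝ ∞ G → ∀ y,
        iteratedFDeriv ℝ (m + 1) G y v =
          fderiv ℝ (fun z => iteratedFDeriv ℝ m G z (Fin.tail v)) y (v 0) := by
      intro G hG y
      rw [iteratedFDeriv_succ_apply_left]
      have hd : DifferentiableAt ℝ (iteratedFDeriv ℝ m G) y :=
        (hG.differentiable_iteratedFDeriv (by exact_mod_cast ENat.natCast_lt_top m)) y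
      have := ((ContinuousMultilinearMap.apply ℝ (fun _ : Fin m => EuclideanSpace ℝ (Fin d)) ℝ
        (Fin.tail v)).hasFDerivAt.comp y hd.hasFDerivAt).fderiv
      exact (congrArg (fun L => L (v 0)) this).symm
    rw [key _ hconv]
    simp_rw [ih (Fin.tail v)]
    have hc' := hasCompactSupport_iteratedFDeriv_apply hc m (Fin.tail v)
    have hφ' := contDiff_iteratedFDeriv_apply hφ m (Fin.tail v)
    rw [(hc'.hasFDerivAt_convolution_left (ContinuousLinearMap.lsmul ℝ ℝ)
      (hφ'.of_le (by exact_mod_cast le_top)) hF x).fderiv]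
    have hce : ConvolutionExistsAt
        (fderiv ℝ fun y => iteratedFDeriv ℝ m φ y (Fin.tail v)) F x
        ((ContinuousLinearMap.lsmul ℝ ℝ).precompL (EuclideanSpace ℝ (Fin d))) volume :=
      (hc'.fderiv ℝ).convolutionExists_left _ (hφ'.continuous_fderiv (by simp)) hF x
    simp only [convolution]
    rw [ContinuousLinearMap.integral_apply hce]
    congr 1
    ext t
    rw [key _ hφ]
    rfl

lemma iteratedFDeriv_const_sub_apply {φ : EuclideanSpace ℝ (Fin d) → ℝ} (hφ : ContDiff ℝ ∞ φ)
    (m : ℕ) (v : Fin m → EuclideanSpace ℝ (Fin d)) (x t : EuclideanSpace ℝ (Fin d)) :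
    iteratedFDeriv ℝ m (fun y => φ (x - y)) t v = (-1) ^ m * iteratedFDeriv ℝ m φ (x - t) v := by
  have e : (fun y => φ (x - y)) =
      (fun z => φ (x + z)) ∘ (-ContinuousLinearMap.id ℝ (EuclideanSpace ℝ (Fin d))) := by
    ext y; simp [sub_eq_add_neg]
  have h1 : ContDiff ℝ ∞ fun z => φ (x + z) := hφ.comp (contDiff_const.add contDiff_id)
  rw [e, ContinuousLinearMap.iteratedFDeriv_comp_right _ h1 _ (i := m) (by exact_mod_cast le_top)]
  simp only [ContinuousMultilinearMap.compContinuousLinearMap_apply,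
    _root_.neg_apply, ContinuousLinearMap.id_apply]
  have h2 := (iteratedFDeriv ℝ m (fun z => φ (x + z)) (-t)).map_smul_univ (fun _ => (-1 : ℝ)) v
  simp only [neg_smul, one_smul, Finset.prod_const, Finset.card_univ, Fintype.card_fin,
    smul_eq_mul] at h2
  rw [h2, iteratedFDeriv_comp_add_left, sub_eq_add_neg]

/-- Well inside Ω the reflected bump t ↦ φ(x - t) is an admissible test function. The sign (-1)^m
from the reflection cancels the one from integration by parts. -/
lemma iteratedFDeriv_mollify_apply {m : ℕ} {w : Fin m → Fin d}
    {g : EuclideanSpace ℝ (Fin d) → ℝ} (hΩ : MeasurableSet Ω)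
    (hf : LocallyIntegrable (Ω.indicator f)) (hg : HasWeakPartial Ω w f g) (n : ℕ)
    (x : EuclideanSpace ℝ (Fin d)) (hx : Metric.closedBall x (1 / ((n : ℝ) + 1)) ⊆ Ω) :
    iteratedFDeriv ℝ m (mollify Ω f n) x (fun i => EuclideanSpace.single (w i) (1 : ℝ)) =
      ∫ t in Ω, g t * (bump d n).normed volume (x - t) := by
  set φ := (bump d n).normed (volume : Measure (EuclideanSpace ℝ (Fin d))) with hφ
  have hφs : ContDiff ℝ ∞ φ := (bump d n).contDiff_normed
  set v : Fin m → EuclideanSpace ℝ (Fin d) := fun i => EuclideanSpace.single (w i) (1 : ℝ)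
  have hts : tsupport (fun y => φ (x - y)) ⊆ Metric.closedBall x (1 / ((n : ℝ) + 1)) := by
    refine closure_minimal (fun y hy => ?_) Metric.isClosed_closedBall
    have : x - y ∈ Function.support φ := hy
    rw [hφ, ContDiffBump.support_normed_eq, mem_ball_zero_iff, bump_rOut] at this
    rw [mem_closedBall_iff_norm, norm_sub_rev]
    exact this.le
  have hψ := hg (fun y => φ (x - y)) (hφs.comp (contDiff_const.sub contDiff_id))
    (HasCompactSupport.intro' (isCompact_closedBall x (1 / ((n : ℝ) + 1)))
      Metric.isClosed_closedBall fun y hy => by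
        by_contra h
        exact hy (hts (subset_tsupport _ h)))
    (hts.trans hx)
  have hone : ((-1 : ℝ) ^ m) * (-1) ^ m = 1 := by rw [← mul_pow]; simp
  rw [mollify, iteratedFDeriv_convolution_apply (bump d n).hasCompactSupport_normed hφs hf,
    convolution_lsmul_swap]
  calc ∫ t, iteratedFDeriv ℝ m φ (x - t) v • Ω.indicator f t
      = ∫ t in Ω, f t * iteratedFDeriv ℝ m φ (x - t) v := by
        rw [← integral_indicator hΩ]
        congr 1
        ext t
        by_cases ht : t ∈ Ω <;> simp [ht, mul_comm]
    _ = (-1) ^ m * ∫ t in Ω, f t * iteratedFDeriv ℝ m (fun y => φ (x - y)) t v := by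
        simp_rw [iteratedFDeriv_const_sub_apply hφs, mul_left_comm (f _)]
        rw [integral_const_mul, ← mul_assoc, hone, one_mul]
    _ = ∫ t in Ω, g t * φ (x - t) := by
        rw [hψ, ← mul_assoc, hone, one_mul]

lemma integral_normed_const_sub (n : ℕ) (x : EuclideanSpace ℝ (Fin d)) :
    ∫ t, (bump d n).normed volume (x - t) = 1 := by
  rw [integral_sub_left_eq_self (fun t => (bump d n).normed volume t)]
  exact (bump d n).integral_normed

lemma integrable_normed_const_sub (n : ℕ) (x : EuclideanSpace ℝ (Fin d)) :
    Integrable fun t => (bump d n).normed volume (x - t) :=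
  (bump d n).integrable_normed.comp_sub_left x

/-- On the support of the bump |x - t| < 1, so the weight passes under the integral at the cost of
2^s; the bump has total mass 1. -/
lemma jap_rpow_mul_abs_integral_le {s M : ℝ} (hs : 0 ≤ s) {g : EuclideanSpace ℝ (Fin d) → ℝ}
    (hM : ∀ᵐ t ∂volume.restrict Ω, jap t ^ s * |g t| ≤ M) (hM0 : 0 ≤ M) (n : ℕ)
    (x : EuclideanSpace ℝ (Fin d)) :
    jap x ^ s * |∫ t in Ω, g t * (bump d n).normed volume (x - t)| ≤ 2 ^ s * M := by
  have hjx : 0 < jap x ^ s := Real.rpow_pos_of_pos (jap_pos x) _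
  have h1 : ‖∫ t in Ω, g t * (bump d n).normed volume (x - t)‖ ≤
      ∫ t in Ω, 2 ^ s * M / jap x ^ s * (bump d n).normed volume (x - t) := by
    refine norm_integral_le_of_norm_le
      ((integrable_normed_const_sub n x).integrableOn.const_mul _) ?_
    filter_upwards [hM] with t ht
    rw [norm_mul, Real.norm_eq_abs, Real.norm_of_nonneg ((bump d n).nonneg_normed _)]
    by_cases h0 : (bump d n).normed volume (x - t) = 0
    · simp [h0]
    · refine mul_le_mul_of_nonneg_right ?_ ((bump d n).nonneg_normed _)
      have h2 : x - t ∈ Function.support ((bump d n).normed volume) := h0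
      rw [ContDiffBump.support_normed_eq, mem_ball_zero_iff, bump_rOut] at h2
      have h3 : 1 / ((n : ℝ) + 1) ≤ 1 := by
        rw [div_le_one (by positivity)]
        linarith [(n.cast_nonneg : (0 : ℝ) ≤ n)]
      have h4 : jap x ^ s ≤ 2 ^ s * jap t ^ s := by
        rw [← Real.mul_rpow zero_le_two (jap_pos t).le]
        exact Real.rpow_le_rpow (jap_pos x).le (jap_le_two_mul (h2.le.trans h3)) hs
      rw [le_div_iff₀ hjx]
      calc |g t| * jap x ^ s ≤ |g t| * (2 ^ s * jap t ^ s) := by gcongr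
        _ = 2 ^ s * (jap t ^ s * |g t|) := by ring
        _ ≤ 2 ^ s * M := by gcongr
  have h5 : ∫ t in Ω, (bump d n).normed volume (x - t) ≤ 1 := by
    rw [← integral_normed_const_sub n x]
    exact setIntegral_le_integral (integrable_normed_const_sub n x)
      (Eventually.of_forall fun t => (bump d n).nonneg_normed _)
  rw [integral_const_mul, Real.norm_eq_abs] at h1
  calc jap x ^ s * |∫ t in Ω, g t * (bump d n).normed volume (x - t)|
      ≤ jap x ^ s * (2 ^ s * M / jap x ^ s * 1) := by
        refine mul_le_mul_of_nonneg_left (h1.trans ?_) hjx.le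
        gcongr
    _ = 2 ^ s * M := by field_simp

/-- Weak derivatives are given along coordinate directions only; multilinear expansion in the basis
recovers the full operator norm. -/
lemma norm_multilinear_le_sum_single {m : ℕ} (T : EuclideanSpace ℝ (Fin d) [×m]→L[ℝ] ℝ) :
    ‖T‖ ≤ ∑ w : Fin m → Fin d, |T fun i => EuclideanSpace.single (w i) (1 : ℝ)| := by
  refine T.opNorm_le_bound (Finset.sum_nonneg fun _ _ => abs_nonneg _) fun x => ?_
  have hx : ∀ i, x i = ∑ k, (x i k) • EuclideanSpace.single k (1 : ℝ) := by
    intro i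
    ext l
    simp [Finset.sum_apply, Pi.single_apply]
  have h1 : T x = ∑ w : Fin m → Fin d, (∏ i, x i (w i)) *
      T fun i => EuclideanSpace.single (w i) (1 : ℝ) := by
    conv_lhs => rw [show x = fun i => ∑ k, (x i k) • EuclideanSpace.single k (1 : ℝ) from
      funext hx]
    rw [T.map_sum]
    refine Finset.sum_congr rfl fun w _ => ?_
    rw [T.map_smul_univ, smul_eq_mul]
  rw [h1, Finset.sum_mul]
  refine (norm_sum_le _ _).trans (Finset.sum_le_sum fun w _ => ?_)
  rw [norm_mul, Real.norm_eq_abs, Real.norm_eq_abs, mul_comm, Finset.abs_prod]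
  gcongr with i
  exact PiLp.norm_apply_le (x i) (w i)

/-- Mollifications of a function in a weighted Sobolev space are bounded in weighted `C^k`. -/
theorem MemWeightedSobolev.exists_mollify_bound {k : ℕ} {s : ℝ} (hs : 0 ≤ s)
    (hΩ : MeasurableSet Ω) (hf : MemWeightedSobolev k s Ω f) :
    ∃ M : ℝ, 0 ≤ M ∧ ∀ (n : ℕ) (x : EuclideanSpace ℝ (Fin d)),
      Metric.closedBall x (1 / ((n : ℝ) + 1)) ⊆ Ω → ∀ m ≤ k,
        jap x ^ s * ‖iteratedFDeriv ℝ m (mollify Ω f n) x‖ ≤ M := by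
  have hli := hf.1.locallyIntegrable hs hΩ
  have h : ∀ m : Fin (k + 1), ∀ w : Fin m → Fin d, ∃ M : ℝ, 0 ≤ M ∧
      ∀ (n : ℕ) (x : EuclideanSpace ℝ (Fin d)), Metric.closedBall x (1 / ((n : ℝ) + 1)) ⊆ Ω →
        jap x ^ s * |iteratedFDeriv ℝ m (mollify Ω f n) x
          (fun i => EuclideanSpace.single (w i) (1 : ℝ))| ≤ M := by
    intro m w
    obtain ⟨g, hg, -, M, hM⟩ := hf.2 m (Nat.lt_succ_iff.1 m.2) w
    refine ⟨2 ^ s * |M|, by positivity, fun n x hx => ?_⟩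
    rw [iteratedFDeriv_mollify_apply hΩ hli hg n x hx]
    refine jap_rpow_mul_abs_integral_le hs ?_ (abs_nonneg M) n x
    filter_upwards [hM] with t ht
    exact ht.trans (le_abs_self M)
  choose B hB0 hB using h
  refine ⟨∑ m, ∑ w, B m w, Finset.sum_nonneg fun m _ => Finset.sum_nonneg fun w _ => hB0 m w,
    fun n x hx m hm => ?_⟩
  have hjx : 0 ≤ jap x ^ s := (Real.rpow_pos_of_pos (jap_pos x) _).le
  calc jap x ^ s * ‖iteratedFDeriv ℝ m (mollify Ω f n) x‖
      ≤ jap x ^ s * ∑ w : Fin m → Fin d, |iteratedFDeriv ℝ m (mollify Ω f n) x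
          fun i => EuclideanSpace.single (w i) (1 : ℝ)| :=
        mul_le_mul_of_nonneg_left (norm_multilinear_le_sum_single _) hjx
    _ ≤ ∑ w, B ⟨m, Nat.lt_succ_iff.2 hm⟩ w := by
        rw [Finset.mul_sum]
        exact Finset.sum_le_sum fun w _ => hB ⟨m, Nat.lt_succ_iff.2 hm⟩ w n x hx
    _ ≤ ∑ m, ∑ w, B m w :=
        Finset.single_le_sum (f := fun m => ∑ w, B m w)
          (fun m _ => Finset.sum_nonneg fun w _ => hB0 m w) (Finset.mem_univ _)

/-- The evaluation points move with n because in a composition the inner map is mollified at the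
same time as the outer function. -/
lemma tendsto_mollify (hΩ : IsOpen Ω) (hf : LocallyIntegrable (Ω.indicator f))
    (hfc : ContinuousOn f Ω) {x : EuclideanSpace ℝ (Fin d)} (hx : x ∈ Ω)
    {y : ℕ → EuclideanSpace ℝ (Fin d)} (hy : Tendsto y atTop (𝓝 x)) :
    Tendsto (fun n => mollify Ω f n (y n)) atTop (𝓝 (f x)) := by
  refine ContDiffBump.convolution_tendsto_right (φ := bump d) ?_
    (Eventually.of_forall fun _ => hf.aestronglyMeasurable) ?_ hy
  · simp_rw [bump_rOut]
    exact tendsto_one_div_add_atTop_nhds_zero_nat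
  · have h1 : Tendsto (Ω.indicator f) (𝓝 x) (𝓝 (f x)) := by
      refine (hfc.continuousAt (hΩ.mem_nhds hx)).congr' ?_
      filter_upwards [hΩ.mem_nhds hx] with z hz
      rw [indicator_of_mem hz]
    exact h1.comp tendsto_snd

/-- With weight exponent 0 the loss 2^s is 1. The sharp constant keeps vertical components of
mollified displacements within the slab. -/
lemma abs_mollify_le {B : ℝ} (hB : ∀ x, |f x| ≤ B) (n : ℕ) (x : EuclideanSpace ℝ (Fin d)) :
    |mollify univ f n x| ≤ B := by
  have hB0 : 0 ≤ B := (abs_nonneg _).trans (hB x)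
  have h := jap_rpow_mul_abs_integral_le (Ω := univ) (s := 0) (M := B) (g := f) le_rfl
    (Eventually.of_forall fun t => by simpa using hB t) hB0 n x
  rw [mollify_apply MeasurableSet.univ]
  simpa [mul_comm] using h

end Mollify

/-! ### Iterated differences -/

lemma fderiv_iteratedFDeriv_norm_le_segment {E : Type*} [NormedAddCommGroup E] [NormedSpace ℝ E]
    {g : E → ℝ} (hg : ContDiff ℝ ∞ g) (n : ℕ) {x h : E} {M : ℝ}
    (hM : ∀ y ∈ segment ℝ x (x + h), ‖iteratedFDeriv ℝ (n + 1) g y‖ ≤ M) :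
    ‖iteratedFDeriv ℝ n g (x + h) - iteratedFDeriv ℝ n g x‖ ≤ M * ‖h‖ := by
  have hd : Differentiable ℝ (iteratedFDeriv ℝ n g) :=
    hg.differentiable_iteratedFDeriv (by exact_mod_cast ENat.natCast_lt_top n)
  have := (convex_segment x (x + h)).norm_image_sub_le_of_norm_fderiv_le (𝕜 := ℝ)
    (fun y _ => hd y) (C := M) (fun y hy => by rw [norm_fderiv_iteratedFDeriv]; exact hM y hy)
    (left_mem_segment ℝ x (x + h)) (right_mem_segment ℝ x (x + h))
  simpa using this

/-- Iterated differences of a smooth function are controlled by its iterated derivatives. -/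
theorem abs_fwdDiff_iter_le {E : Type*} [NormedAddCommGroup E] [NormedSpace ℝ E] (n : ℕ) :
    ∀ {g : E → ℝ}, ContDiff ℝ ∞ g → ∀ {x h : E} {M : ℝ},
      (∀ y ∈ Metric.closedBall x (n * ‖h‖), ‖iteratedFDeriv ℝ n g y‖ ≤ M) →
      |(fwdDiff h)^[n] g x| ≤ M * ‖h‖ ^ n := by
  induction n with
  | zero =>
    intro g _ x h M hM
    have := hM x (by simp)
    simpa using this
  | succ n ih =>
    intro g hg x h M hM
    have hgs : ContDiff ℝ ∞ fun y => g (y + h) := hg.comp (contDiff_id.add contDiff_const)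
    have hd : ContDiff ℝ ∞ (fwdDiff h g) := hgs.sub hg
    rw [Function.iterate_succ_apply, pow_succ', ← mul_assoc]
    -- One difference is removed: the n-th derivative of the difference is an increment of the n-th
    -- derivative, controlled by the mean value inequality. The extra step enlarges the ball by ‖h‖.
    refine ih hd fun y hy => ?_
    have e : iteratedFDeriv ℝ n (fwdDiff h g) y =
        iteratedFDeriv ℝ n g (y + h) - iteratedFDeriv ℝ n g y := by
      rw [← iteratedFDeriv_comp_add_right]
      exact iteratedFDeriv_sub_apply (hgs.contDiffAt.of_le (by exact_mod_cast le_top))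
        (hg.contDiffAt.of_le (by exact_mod_cast le_top))
    rw [e]
    refine fderiv_iteratedFDeriv_norm_le_segment hg n fun z hz => hM z ?_
    rw [Metric.mem_closedBall] at hy
    have hsub : segment ℝ y (y + h) ⊆ Metric.closedBall x ((n + 1 : ℕ) * ‖h‖) := by
      refine (convex_closedBall x _).segment_subset ?_ ?_
      · rw [Metric.mem_closedBall]
        push_cast
        nlinarith [norm_nonneg h]
      · rw [Metric.mem_closedBall]
        have := dist_triangle (y + h) y x
        rw [dist_self_add_left] at this
        push_cast
        linarith
    exact hsub hz

/-- A difference is a finite combination of point values, so pointwise convergence suffices and no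
derivative of the limit is needed. -/
lemma tendsto_fwdDiff_iter {E ι : Type*} [AddCommGroup E] {l : Filter ι} {f : ι → E → ℝ}
    {g : E → ℝ} {x h : E} (n : ℕ)
    (hf : ∀ k ≤ n, Tendsto (fun i => f i (x + k • h)) l (𝓝 (g (x + k • h)))) :
    Tendsto (fun i => (fwdDiff h)^[n] (f i) x) l (𝓝 ((fwdDiff h)^[n] g x)) := by
  simp_rw [fwdDiff_iter_eq_sum_shift]
  exact tendsto_finsetSum _ fun k hk =>
    (hf k (Nat.lt_succ_iff.1 (Finset.mem_range.1 hk))).const_smul _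

lemma add_nsmul_mem_closedBall {E : Type*} [NormedAddCommGroup E] [NormedSpace ℝ E] (x h : E)
    {k n : ℕ} (hk : k ≤ n) : x + k • h ∈ Metric.closedBall x (n * ‖h‖) := by
  rw [mem_closedBall_iff_norm, add_sub_cancel_left]
  refine (norm_nsmul_le).trans ?_
  gcongr

/-! ### Composition with approximately smooth maps -/

/-- `S` is the limit of smooth maps `T n` whose derivatives of order `1 ≤ i ≤ k` are bounded by
`D ^ i`. -/
structure IsSmoothApprox {E F : Type*} [NormedAddCommGroup E] [NormedSpace ℝ E]
    [NormedAddCommGroup F] [NormedSpace ℝ F] (k : ℕ) (D : ℝ) (S : E → F) (T : ℕ → E → F) :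
    Prop where
  contDiff : ∀ n, ContDiff ℝ ∞ (T n)
  bound : ∀ n x i, 1 ≤ i → i ≤ k → ‖iteratedFDeriv ℝ i (T n) x‖ ≤ D ^ i
  tendsto : ∀ x, Tendsto (fun n => T n x) atTop (𝓝 (S x))

lemma IsSmoothApprox.clm_comp {E F G : Type*} [NormedAddCommGroup E] [NormedSpace ℝ E]
    [NormedAddCommGroup F] [NormedSpace ℝ F] [NormedAddCommGroup G] [NormedSpace ℝ G] {k : ℕ}
    {D : ℝ} {S : E → F} {T : ℕ → E → F} (h : IsSmoothApprox k D S T) (L : F →L[ℝ] G)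
    (hL : ‖L‖ ≤ 1) : IsSmoothApprox k D (fun x => L (S x)) fun n x => L (T n x) where
  contDiff n := L.contDiff.comp (h.contDiff n)
  bound n x i h1 h2 := by
    have := L.norm_iteratedFDeriv_comp_left (f := T n) (x := x) (N := ∞) (n := i)
      (h.contDiff n).contDiffAt (by exact_mod_cast le_top)
    refine this.trans ((mul_le_of_le_one_left (norm_nonneg _) hL).trans (h.bound n x i h1 h2))
  tendsto x := (L.continuous.tendsto _).comp (h.tendsto x)

/-- Iterated differences and values of compositions with a function in a weighted Sobolev space. -/
theorem MemWeightedSobolev.exists_fwdDiff_comp_bound {d k : ℕ} {s : ℝ} (hs : 0 ≤ s)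
    {Ω : Set (EuclideanSpace ℝ (Fin d))} {f : EuclideanSpace ℝ (Fin d) → ℝ} (hΩ : IsOpen Ω)
    (hfc : ContinuousOn f Ω) (hf : MemWeightedSobolev k s Ω f) :
    ∃ M : ℝ, 0 ≤ M ∧ (∀ x ∈ Ω, jap x ^ s * |f x| ≤ M) ∧
      ∀ {E : Type} [NormedAddCommGroup E] [NormedSpace ℝ E] (S : E → EuclideanSpace ℝ (Fin d))
        (T : ℕ → E → EuclideanSpace ℝ (Fin d)) (D W δ : ℝ) (x h : E),
        IsSmoothApprox k D S T → 0 ≤ D → 0 < W → 0 < δ →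
        (∀ n, ∀ y ∈ Metric.closedBall x (k * ‖h‖), W ≤ jap (T n y) ^ s) →
        (∀ n, ∀ y ∈ Metric.closedBall x (k * ‖h‖), Metric.closedBall (T n y) δ ⊆ Ω) →
        |(fwdDiff h)^[k] (f ∘ S) x| ≤ M * D ^ k / W * ‖h‖ ^ k := by
  obtain ⟨M, hM0, hM⟩ := hf.exists_mollify_bound hs hΩ.measurableSet
  have hli := hf.1.locallyIntegrable hs hΩ.measurableSet
  have hsmall : ∀ δ > 0, ∀ᶠ n : ℕ in atTop, 1 / ((n : ℝ) + 1) < δ := fun δ hδ =>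
    tendsto_one_div_add_atTop_nhds_zero_nat.eventually_lt_const hδ
  have hfact : (1 : ℝ) ≤ k.factorial := by exact_mod_cast Nat.succ_le_of_lt k.factorial_pos
  -- The factorial is the constant of the chain rule estimate; the bound on values needs only that
  -- it is at least 1.
  refine ⟨k.factorial * M, by positivity, fun x hx => ?_, ?_⟩
  · obtain ⟨δ, hδ, hball⟩ := Metric.isOpen_iff.1 hΩ x hx
    have h1 : Tendsto (fun n => jap x ^ s * |mollify Ω f n x|) atTop (𝓝 (jap x ^ s * |f x|)) :=
      (tendsto_mollify hΩ hli hfc hx tendsto_const_nhds).abs.const_mul _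
    refine le_of_tendsto h1 ?_
    filter_upwards [hsmall δ hδ] with n hn
    have := hM n x ((Metric.closedBall_subset_ball hn).trans hball) 0 (Nat.zero_le _)
    rw [norm_iteratedFDeriv_zero, Real.norm_eq_abs] at this
    nlinarith
  · intro E _ _ S T D W δ x h hT hD hW hδ hTW hTΩ
    have hlim : Tendsto (fun n => (fwdDiff h)^[k] (mollify Ω f n ∘ T n) x) atTop
        (𝓝 ((fwdDiff h)^[k] (f ∘ S) x)) := by
      refine tendsto_fwdDiff_iter k fun i hi => ?_
      set y := x + i • h with hy
      have hyb : y ∈ Metric.closedBall x (k * ‖h‖) := add_nsmul_mem_closedBall x h hi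
      refine tendsto_mollify hΩ hli hfc ?_ (hT.tendsto y)
      -- The limit point lies within δ of some approximating point, hence in Ω.
      obtain ⟨n, hn⟩ := (Metric.tendsto_nhds.1 (hT.tendsto y) δ hδ).exists
      refine hTΩ n y hyb ?_
      rw [Metric.mem_closedBall, dist_comm]
      exact hn.le
    refine le_of_tendsto hlim.abs ?_
    filter_upwards [hsmall δ hδ] with n hn
    refine abs_fwdDiff_iter_le k ((contDiff_mollify hli n).comp (hT.contDiff n)) fun y hy => ?_
    -- The Faà di Bruno estimate requires inner derivatives of order i to be at most D^i, and outer
    -- derivatives of every order up to k to share one bound, here M / W.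
    have := norm_iteratedFDeriv_comp_le (contDiff_mollify hli n) (hT.contDiff n) (n := k)
      (by exact_mod_cast le_top) y (C := M / W) (D := D) (fun i hi => ?_) (fun i h1 h2 =>
        hT.bound n y i h1 h2)
    · refine this.trans (le_of_eq (by ring))
    · have h3 := hM n (T n y) ((Metric.closedBall_subset_closedBall hn.le).trans (hTΩ n y hy)) i hi
      rw [le_div_iff₀ hW, mul_comm]
      exact (mul_le_mul_of_nonneg_right (hTW n y hy) (norm_nonneg _)).trans h3

/-! ### The slab -/

/-- The horizontal projection `(x, y, z) ↦ (x, y)`. -/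
noncomputable def horL : R3 →L[ℝ] R2 :=
  LinearMap.toContinuousLinearMap
    { toFun := fun x => !₂[x 0, x 1]
      map_add' := fun x y => by ext i; fin_cases i <;> simp
      map_smul' := fun c x => by ext i; fin_cases i <;> simp }

lemma horL_apply (x : R3) : horL x = !₂[x 0, x 1] := rfl

/-- The vertical rescaling `(x, y, z) ↦ (x, y, c z)`. -/
noncomputable def vertL (c : ℝ) : R3 →L[ℝ] R3 :=
  LinearMap.toContinuousLinearMap
    { toFun := fun x => !₂[x 0, x 1, c * x 2]
      map_add' := fun x y => by ext i; fin_cases i <;> simp [mul_add]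
      map_smul' := fun a x => by ext i; fin_cases i <;> simp [mul_left_comm] }

lemma vertL_apply (c : ℝ) (x : R3) : vertL c x = !₂[x 0, x 1, c * x 2] := rfl

lemma norm_sq_R3 (x : R3) : ‖x‖ ^ 2 = x 0 ^ 2 + x 1 ^ 2 + x 2 ^ 2 := by
  rw [EuclideanSpace.norm_sq_eq, Fin.sum_univ_three]; simp

lemma norm_sq_R2 (x : R2) : ‖x‖ ^ 2 = x 0 ^ 2 + x 1 ^ 2 := by
  rw [EuclideanSpace.norm_sq_eq, Fin.sum_univ_two]; simp

lemma norm_horL_apply_le (x : R3) : ‖horL x‖ ≤ ‖x‖ := by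
  refine abs_le_of_sq_le_sq' ?_ (norm_nonneg _) |>.2
  rw [norm_sq_R3, norm_sq_R2, horL_apply]
  simp
  nlinarith [sq_nonneg (x 2)]

lemma norm_horL_le : ‖horL‖ ≤ 1 :=
  horL.opNorm_le_bound zero_le_one fun x => by rw [one_mul]; exact norm_horL_apply_le x

lemma norm_vertL_le {c : ℝ} (h0 : 0 ≤ c) (h1 : c ≤ 1) : ‖vertL c‖ ≤ 1 := by
  refine (vertL c).opNorm_le_bound zero_le_one fun x => ?_
  rw [one_mul]
  refine abs_le_of_sq_le_sq' ?_ (norm_nonneg _) |>.2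
  rw [norm_sq_R3, norm_sq_R3, vertL_apply]
  simp only [Matrix.cons_val_zero, Matrix.cons_val_one, Matrix.cons_val]
  have : c ^ 2 ≤ 1 := by nlinarith
  nlinarith [sq_nonneg (x 2)]

lemma jap_le_jap {E F : Type*} [NormedAddCommGroup E] [NormedAddCommGroup F] {x : E} {y : F}
    (h : ‖x‖ ≤ ‖y‖) : jap x ≤ jap y := by
  unfold jap; gcongr

lemma horL_vertL (c : ℝ) (x : R3) : horL (vertL c x) = horL x := by
  simp [horL_apply, vertL_apply]

lemma continuous_vertL_apply (x : R3) : Continuous fun c => vertL c x := by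
  simp only [vertL_apply]
  fun_prop

/-- Values and iterated differences of compositions with a function in a weighted Sobolev space on
a slab that may be degenerate. -/
theorem MemSobolevSlab.exists_fwdDiff_comp_bound {k : ℕ} {s L : ℝ} (hs : 0 ≤ s) (hL : 0 ≤ L)
    {v : R3 → ℝ} (hv : MemSobolevSlab k s L v) :
    ∃ M : ℝ, 0 ≤ M ∧ (∀ x : R3, |x 2| ≤ L → jap (horL x) ^ s * |v x| ≤ M) ∧
      ∀ {E : Type} [NormedAddCommGroup E] [NormedSpace ℝ E] (S : E → R3) (T : ℕ → E → R3)
        (D W : ℝ) (x h : E), IsSmoothApprox k D S T → 0 ≤ D → 0 < W → (∀ n y, |T n y 2| ≤ L) →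
        (∀ n, ∀ y ∈ Metric.closedBall x (k * ‖h‖), W ≤ jap (horL (T n y)) ^ s) →
        |(fwdDiff h)^[k] (v ∘ S) x| ≤ M * D ^ k / W * ‖h‖ ^ k := by
  obtain ⟨hc, hpos, hzero⟩ := hv
  have hSL : ∀ {E : Type} [NormedAddCommGroup E] [NormedSpace ℝ E] {S : E → R3} {T : ℕ → E → R3}
      {D : ℝ}, IsSmoothApprox k D S T → (∀ n y, |T n y 2| ≤ L) → ∀ y, |S y 2| ≤ L := by
    intro E _ _ S T D hT hTL y
    have h1 : Continuous fun z : R3 => |z 2| := by fun_prop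
    exact le_of_tendsto ((h1.tendsto _).comp (hT.tendsto y)) (Eventually.of_forall fun n => hTL n y)
  rcases hL.eq_or_lt with rfl | hL
  -- For L = 0 the third coordinate vanishes, so the composition factors through the plane.
  · have e0 : ∀ x : R3, |x 2| ≤ 0 → toR3 (horL x) = x := by
      intro x hx
      have : x 2 = 0 := abs_eq_zero.1 (le_antisymm hx (abs_nonneg _))
      ext i; fin_cases i <;> simp [toR3, horL_apply, this]
    have hc' : ContinuousOn (fun x => v (toR3 x)) univ := by
      refine hc.comp (Continuous.continuousOn ?_) fun x _ => ?_
      · unfold toR3; fun_prop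
      · simp [toR3]
    obtain ⟨M, hM0, h1, h2⟩ := (hzero rfl).exists_fwdDiff_comp_bound hs isOpen_univ hc'
    refine ⟨M, hM0, fun x hx => ?_, ?_⟩
    · have := h1 (horL x) (mem_univ _)
      rwa [e0 x hx] at this
    · intro E _ _ S T D W x h hT hD hW hTL hTW
      have e : v ∘ S = (fun x => v (toR3 x)) ∘ fun y => horL (S y) := by
        ext y
        simp only [Function.comp_apply]
        rw [e0 _ (hSL hT hTL y)]
      rw [e]
      exact h2 _ (fun n y => horL (T n y)) D W 1 x h (hT.clm_comp horL norm_horL_le) hD hW one_pos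
        hTW fun _ _ _ => subset_univ _
  · have hΩ : IsOpen {x : R3 | |x 2| < L} := isOpen_lt (by fun_prop) continuous_const
    have hc' : ContinuousOn v {x : R3 | |x 2| < L} := hc.mono fun x (hx : |x 2| < L) => hx.le
    obtain ⟨M, hM0, h1, h2⟩ := (hpos hL).exists_fwdDiff_comp_bound hs hΩ hc'
    -- Sobolev bounds hold only in the open slab; vertical compression by c < 1 moves points inside,
    -- and continuity on the closed slab allows c → 1.
    have hlim : ∀ x : R3, |x 2| ≤ L → Tendsto (fun c => v (vertL c x)) (𝓝[<] 1) (𝓝 (v x)) := by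
      intro x hx
      have h3 : Tendsto (fun c => vertL c x) (𝓝[<] 1) (𝓝[{x : R3 | |x 2| ≤ L}] x) := by
        refine tendsto_nhdsWithin_iff.2 ⟨?_, ?_⟩
        · have := ((continuous_vertL_apply x).tendsto 1).mono_left
            (nhdsWithin_le_nhds (s := Iio (1 : ℝ)))
          have e : vertL 1 x = x := by ext i; fin_cases i <;> simp [vertL_apply]
          rwa [e] at this
        · filter_upwards [Ioo_mem_nhdsLT (zero_lt_one (α := ℝ))] with c hc
          change |(vertL c x) 2| ≤ L
          simp only [vertL_apply, Matrix.cons_val, abs_mul, abs_of_pos hc.1]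
          nlinarith [abs_nonneg (x 2), hc.2]
      exact (hc x hx).tendsto.comp h3
    have hvert : ∀ (x : R3) (c : ℝ), |x 2| ≤ L → 0 < c → c < 1 → |(vertL c x) 2| ≤ c * L := by
      intro x c hx h0 _
      simp only [vertL_apply, Matrix.cons_val, abs_mul, abs_of_pos h0]
      gcongr
    refine ⟨M, hM0, fun x hx => ?_, ?_⟩
    · refine le_of_tendsto ((hlim x hx).abs.const_mul _) ?_
      filter_upwards [Ioo_mem_nhdsLT (zero_lt_one (α := ℝ))] with c hc
      have h3 : |(vertL c x) 2| < L := by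
        have := hvert x c hx hc.1 hc.2
        nlinarith [hc.2]
      refine le_trans ?_ (h1 _ h3)
      gcongr
      · exact (jap_pos _).le
      · rw [← horL_vertL c x]
        exact jap_le_jap (norm_horL_apply_le _)
    · intro E _ _ S T D W x h hT hD hW hTL hTW
      have hl : Tendsto (fun c => (fwdDiff h)^[k] (v ∘ fun y => vertL c (S y)) x) (𝓝[<] 1)
          (𝓝 ((fwdDiff h)^[k] (v ∘ S) x)) :=
        tendsto_fwdDiff_iter k fun i _ => hlim _ (hSL hT hTL _)
      refine le_of_tendsto hl.abs ?_
      filter_upwards [Ioo_mem_nhdsLT (zero_lt_one (α := ℝ))] with c hc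
      -- Compressed points have height at most cL, so balls of radius (1 - c)L/2 stay in the open
      -- slab. The resulting bound does not involve this radius, so it survives c → 1.
      refine h2 _ (fun n y => vertL c (T n y)) D W ((1 - c) * L / 2) x h
        (hT.clm_comp (vertL c) (norm_vertL_le hc.1.le hc.2.le)) hD hW
        (by have := hc.2; have : 0 < 1 - c := by linarith
            positivity) (fun n y hy => (hTW n y hy).trans ?_) fun n y _ z hz => ?_
      · gcongr
        · exact (jap_pos _).le
        · rw [← horL_vertL c]
          exact jap_le_jap (norm_horL_apply_le _)
      · rw [mem_closedBall_iff_norm] at hz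
        have h5 := PiLp.norm_apply_le (z - vertL c (T n y)) 2
        rw [Real.norm_eq_abs, PiLp.sub_apply] at h5
        have h6 := hvert (T n y) c (hTL n y) hc.1 hc.2
        have h7 := abs_sub_abs_le_abs_sub (z 2) ((vertL c (T n y)) 2)
        change |z 2| < L
        have : 0 < (1 - c) * L := mul_pos (by linarith [hc.2]) hL
        linarith

/-! ### Mollified displacements -/

/-- Componentwise mollification of a displacement. -/
noncomputable def vecMollify (w : R2 → R3) (n : ℕ) (x : R2) : R3 :=
  ∑ i, mollify univ (fun y => w y i) n x • EuclideanSpace.single i (1 : ℝ)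

lemma vecMollify_apply (w : R2 → R3) (n : ℕ) (x : R2) (i : Fin 3) :
    vecMollify w n x i = mollify univ (fun y => w y i) n x := by
  simp [vecMollify, Finset.sum_apply, Pi.single_apply]

lemma norm_iteratedFDeriv_smul_const_le {E F : Type*} [NormedAddCommGroup E] [NormedSpace ℝ E]
    [NormedAddCommGroup F] [NormedSpace ℝ F] {f : E → ℝ} (hf : ContDiff ℝ ∞ f) (e : F) (i : ℕ)
    (x : E) : ‖iteratedFDeriv ℝ i (fun y => f y • e) x‖ ≤ ‖e‖ * ‖iteratedFDeriv ℝ i f x‖ := by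
  have := ((ContinuousLinearMap.id ℝ ℝ).smulRight e).norm_iteratedFDeriv_comp_left
    (f := f) (x := x) (N := ∞) (n := i) hf.contDiffAt (by exact_mod_cast le_top)
  refine this.trans ?_
  gcongr
  rw [ContinuousLinearMap.norm_smulRight_apply]
  exact mul_le_of_le_one_left (norm_nonneg _) ContinuousLinearMap.norm_id_le

/-- Mollifications of a displacement whose components lie in `W^{k,∞}`. -/
lemma exists_vecMollify_bound {k : ℕ} {w : R2 → R3} (hw : Continuous w)
    (hs : ∀ i : Fin 3, MemWeightedSobolev k 0 (univ : Set R2) fun x => w x i) :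
    (∀ n, ContDiff ℝ ∞ (vecMollify w n)) ∧
    (∀ x, Tendsto (fun n => vecMollify w n x) atTop (𝓝 (w x))) ∧
    ∃ M : ℝ, 0 ≤ M ∧ (∀ n x, ∀ i ≤ k, ‖iteratedFDeriv ℝ i (vecMollify w n) x‖ ≤ M) ∧
      (∀ n x, ‖vecMollify w n x‖ ≤ M) ∧ ∀ x, ‖w x‖ ≤ M := by
  have hli := fun i => (hs i).1.locallyIntegrable le_rfl MeasurableSet.univ
  have hcd : ∀ i n, ContDiff ℝ ∞ (mollify univ (fun y => w y i) n) := fun i n =>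
    contDiff_mollify (hli i) n
  have hlim : ∀ x, Tendsto (fun n => vecMollify w n x) atTop (𝓝 (w x)) := by
    intro x
    have h1 : Tendsto (fun n => vecMollify w n x) atTop
        (𝓝 (∑ i, w x i • EuclideanSpace.single i (1 : ℝ))) := by
      refine tendsto_finsetSum _ fun i _ => Tendsto.smul_const ?_ _
      exact tendsto_mollify isOpen_univ (hli i) (by fun_prop) (mem_univ x) tendsto_const_nhds
    convert h1 using 2
    ext l
    simp [Finset.sum_apply, Pi.single_apply]
  choose M hM0 hM using fun i => (hs i).exists_mollify_bound le_rfl MeasurableSet.univ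
  have hd : ∀ n x, ∀ i ≤ k, ‖iteratedFDeriv ℝ i (vecMollify w n) x‖ ≤ ∑ l, M l := by
    intro n x i hi
    have e : iteratedFDeriv ℝ i (vecMollify w n) x = ∑ l : Fin 3, iteratedFDeriv ℝ i
        (fun y => mollify univ (fun y => w y l) n y • EuclideanSpace.single l (1 : ℝ)) x := by
      have := iteratedFDeriv_sum (𝕜 := ℝ) (i := i) (u := Finset.univ)
        (f := fun (l : Fin 3) (y : R2) => mollify univ (fun y => w y l) n y •
          (EuclideanSpace.single l (1 : ℝ) : R3))
        (fun l _ => ((hcd l n).smul contDiff_const).of_le (by exact_mod_cast le_top))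
      have h2 := congrFun this x
      rw [Finset.sum_apply] at h2
      exact h2
    rw [e]
    refine (norm_sum_le _ _).trans (Finset.sum_le_sum fun l _ => ?_)
    refine (norm_iteratedFDeriv_smul_const_le (hcd l n) _ i x).trans ?_
    have := hM l n x (subset_univ _) i hi
    simpa using this
  have h0 : ∀ n x, ‖vecMollify w n x‖ ≤ ∑ l, M l := fun n x => by
    simpa using hd n x 0 (Nat.zero_le _)
  refine ⟨fun n => ContDiff.sum fun i _ => (hcd i n).smul contDiff_const, hlim, ∑ l, M l,
    Finset.sum_nonneg fun l _ => hM0 l, hd, h0, fun x => ?_⟩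
  exact le_of_tendsto (hlim x).norm (Eventually.of_forall fun n => h0 n x)

lemma norm_iteratedFDeriv_affine_le {E F : Type*} [NormedAddCommGroup E] [NormedSpace ℝ E]
    [NormedAddCommGroup F] [NormedSpace ℝ F] (L : E →L[ℝ] F) (c : F) {i : ℕ} (hi : 1 ≤ i) (x : E) :
    ‖iteratedFDeriv ℝ i (fun y => L y + c) x‖ ≤ ‖L‖ := by
  obtain ⟨i, rfl⟩ := Nat.exists_eq_add_of_le' hi
  rw [← norm_iteratedFDeriv_fderiv]
  have e : fderiv ℝ (fun y => L y + c) = fun _ => L := by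
    ext1 y
    rw [fderiv_add_const, L.fderiv]
  rw [e]
  rcases Nat.eq_zero_or_pos i with rfl | h0
  · simp
  · rw [iteratedFDeriv_const_of_ne h0.ne']
    simp

lemma norm_iteratedFDeriv_comp_affine_le {E F G : Type*} [NormedAddCommGroup E] [NormedSpace ℝ E]
    [NormedAddCommGroup F] [NormedSpace ℝ F] [NormedAddCommGroup G] [NormedSpace ℝ G]
    (L : E →L[ℝ] F) (b : F) {f : F → G} (hf : ContDiff ℝ ∞ f) {i : ℕ} {M : ℝ}
    (hM : ∀ y, ‖iteratedFDeriv ℝ i f y‖ ≤ M) (x : E) :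
    ‖iteratedFDeriv ℝ i (fun y => f (L y + b)) x‖ ≤ M * ‖L‖ ^ i := by
  have h1 : ContDiff ℝ ∞ fun z => f (z + b) := hf.comp (contDiff_id.add contDiff_const)
  have e : (fun y => f (L y + b)) = (fun z => f (z + b)) ∘ L := rfl
  rw [e, L.iteratedFDeriv_comp_right h1 x (i := i) (by exact_mod_cast le_top)]
  refine (ContinuousMultilinearMap.norm_compContinuousLinearMap_le _ _).trans ?_
  rw [Finset.prod_const, Finset.card_univ, Fintype.card_fin, iteratedFDeriv_comp_add_right]
  gcongr
  exact hM _

/-- `toR3` as a continuous linear map. -/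
noncomputable def toR3L : R2 →L[ℝ] R3 :=
  LinearMap.toContinuousLinearMap
    { toFun := toR3
      map_add' := toR3_add
      map_smul' := fun c x => by ext i; fin_cases i <;> simp [toR3] }

lemma horL_toR3 (x : R2) : horL (toR3 x) = x := by
  ext i; fin_cases i <;> simp [toR3, horL_apply]

lemma toR3_apply_two (x : R2) : toR3 x 2 = 0 := by simp [toR3]

/-! ### Interlayer stencils of mollified displacements. -/

section Inter

variable {𝒜 : Layer → Type*}

/-- The interlayer stencil, at the disregistry `D x`, of mollified displacements. -/
noncomputable def mollStencil (A : Mat2) (q θ : ℝ) (τ : ∀ k, 𝒜 k → R2) (j : Layer)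
    (u : ∀ k, R2 → 𝒜 k → R3) (α : 𝒜 j) (p : Z2 × 𝒜 j.other) (n : ℕ) (x : R2) : R3 :=
  interStencil A q θ τ j (fun k x α => vecMollify (fun y => u k y α) n x) x
    (act (disreg A q θ j) x) α p

lemma interStencil_apply_two (A : Mat2) (q θ : ℝ) (τ : ∀ k, 𝒜 k → R2) (j : Layer)
    (u : ∀ k, R2 → 𝒜 k → R3) (x y : R2) (α : 𝒜 j) (p : Z2 × 𝒜 j.other) :
    interStencil A q θ τ j u x y α p 2 =
      u j x α 2 - u j.other (x - y + latPt A q θ j.other p.1) p.2 2 := by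
  simp [interStencil, toR3_apply_two]

/-- The horizontal part of the stencil is solved for the lattice point; all remaining terms except y
are bounded. -/
lemma norm_latPt_le_norm_horL_interStencil (A : Mat2) (q θ : ℝ) (τ : ∀ k, 𝒜 k → R2) (j : Layer)
    {u : ∀ k, R2 → 𝒜 k → R3} {B T : ℝ} (hB : ∀ k x α, ‖u k x α‖ ≤ B) (hT : ∀ k α, ‖τ k α‖ ≤ T)
    (x y : R2) (α : 𝒜 j) (p : Z2 × 𝒜 j.other) :
    ‖latPt A q θ j.other p.1‖ ≤
      ‖horL (interStencil A q θ τ j u x y α p)‖ + (‖y‖ + 2 * T + 2 * B) := by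
  have e : latPt A q θ j.other p.1 = -horL (interStencil A q θ τ j u x y α p) + y + τ j α -
      τ j.other p.2 + horL (u j x α) -
        horL (u j.other (x - y + latPt A q θ j.other p.1) p.2) := by
    simp only [interStencil, map_add, map_sub, horL_toR3]
    abel
  have h1 := (norm_horL_apply_le (u j x α)).trans (hB _ _ _)
  have h2 := (norm_horL_apply_le (u j.other (x - y + latPt A q θ j.other p.1) p.2)).trans (hB _ _ _)
  have h3 := hT j α
  have h4 := hT j.other p.2
  calc ‖latPt A q θ j.other p.1‖ = _ := congrArg norm e
    _ ≤ ‖horL (interStencil A q θ τ j u x y α p)‖ + ‖y‖ + ‖τ j α‖ + ‖τ j.other p.2‖ +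
        ‖horL (u j x α)‖ + ‖horL (u j.other (x - y + latPt A q θ j.other p.1) p.2)‖ := by
      refine (norm_sub_le _ _).trans ?_
      gcongr
      refine (norm_add_le _ _).trans ?_
      gcongr
      refine (norm_sub_le _ _).trans ?_
      gcongr
      refine (norm_add_le _ _).trans ?_
      gcongr
      refine (norm_add_le _ _).trans ?_
      rw [norm_neg]
    _ ≤ _ := by linarith

/-- Horizontal distances in the stencil grow linearly in the lattice index. -/
lemma exists_mul_max_le_jap {A : Mat2} (hA : IsUnit A.det) {q : ℝ} (hq : 0 < q) (θ : ℝ) (j : Layer)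
    {ρ : ℝ} (hρ : 0 ≤ ρ) :
    ∃ κ : ℝ, 0 < κ ∧ ∀ (m : Z2) (z : R2), ‖latPt A q θ j m‖ ≤ ‖z‖ + ρ → κ * max 1 ‖m‖ ≤ jap z := by
  obtain ⟨c, hc, hcm⟩ := mul_norm_le_norm_act (isUnit_det_layerMat hA hq θ j)
  -- From c‖m‖ ≤ ‖z‖ + ρ ≤ (1 + ρ) `jap z`, since `jap z` dominates both 1 and ‖z‖.
  refine ⟨min 1 (c / (1 + ρ)), by positivity, fun m z hz => ?_⟩
  have h1 : ‖z‖ ≤ jap z := Real.le_sqrt_of_sq_le (by linarith)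
  have h2 := one_le_jap z
  rw [mul_max_of_nonneg _ _ (by positivity), max_le_iff]
  refine ⟨by rw [mul_one]; exact (min_le_left _ _).trans h2, ?_⟩
  calc min 1 (c / (1 + ρ)) * ‖m‖ ≤ c / (1 + ρ) * ‖m‖ := by gcongr; exact min_le_right _ _
    _ = c * ‖m‖ / (1 + ρ) := by ring
    _ ≤ jap z := by
      rw [div_le_iff₀ (by positivity)]
      have := (hcm m).trans hz
      nlinarith

/-- The cut-off keeps the weight positive at label 0; s > 2 is the convergence threshold on a
two-dimensional lattice. -/
lemma summable_one_div_max_rpow {ι : Type*} [Fintype ι] {κ s : ℝ} (hκ : 0 < κ) (hs : 2 < s) :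
    Summable fun p : Z2 × ι => 1 / (κ * max 1 ‖p.1‖) ^ s := by
  have h1 : Summable fun m : Z2 => 1 / (κ * max 1 ‖m‖) ^ s := by
    refine Summable.of_norm_bounded_eventually
      ((summable_norm_rpow_neg hs).mul_left (κ ^ (-s))) ?_
    filter_upwards [(finite_singleton (0 : Z2)).compl_mem_cofinite] with m hm
    have hm1 := one_le_norm_Z2 hm
    rw [max_eq_right hm1, Real.norm_of_nonneg (by positivity),
      ← Real.mul_rpow hκ.le (norm_nonneg _), Real.rpow_neg (by positivity), one_div]
  have h2 : Summable fun _ : ι => (1 : ℝ) := Summable.of_finite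
  simpa using h1.mul_of_nonneg h2 (fun m => by positivity) fun _ => zero_le_one

/-- The stencil is an affine map plus displacements at affine arguments. The lattice label enters
only through translations, so one derivative bound serves all labels. -/
lemma isSmoothApprox_mollStencil [∀ k, Fintype (𝒜 k)] (A : Mat2) (q θ : ℝ) (τ : ∀ k, 𝒜 k → R2)
    (j : Layer) {u : ∀ k, R2 → 𝒜 k → R3} {k : ℕ} (huc : ∀ l α, Continuous fun x => u l x α)
    (hu : ∀ l α (i : Fin 3), MemWeightedSobolev k 0 (univ : Set R2) fun x => u l x α i)
    {M : ℝ} (hM0 : 0 ≤ M)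
    (hM : ∀ l α n x, ∀ i ≤ k, ‖iteratedFDeriv ℝ i (vecMollify (fun y => u l y α) n) x‖ ≤ M) :
    ∃ D : ℝ, 0 ≤ D ∧ ∀ α p, IsSmoothApprox k D
      (fun x => interStencil A q θ τ j u x (act (disreg A q θ j) x) α p)
      (mollStencil A q θ τ j u α p) := by
  set D := actL (disreg A q θ j) with hD
  set E := ContinuousLinearMap.id ℝ R2 - D with hE
  have e : ∀ (α : 𝒜 j) (p : Z2 × 𝒜 j.other) n, mollStencil A q θ τ j u α p n = fun x =>
      ((toR3L ∘L D) x + toR3 (-latPt A q θ j.other p.1 + τ j α - τ j.other p.2)) +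
        vecMollify (fun y => u j y α) n x -
        vecMollify (fun y => u j.other y p.2) n (E x + latPt A q θ j.other p.1) := by
    intro α p n
    ext1 x
    simp only [mollStencil, interStencil]
    congr 1
    congr 1
    change _ = toR3 (act (disreg A q θ j) x) + _
    rw [← toR3_add]
    congr 1
    abel
  have hcd := fun l α => (exists_vecMollify_bound (huc l α) (hu l α)).1
  have hc1 : ∀ (α : 𝒜 j) (p : Z2 × 𝒜 j.other), ContDiff ℝ ∞ fun x =>
      (toR3L ∘L D) x + toR3 (-latPt A q θ j.other p.1 + τ j α - τ j.other p.2) := fun α p =>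
    (toR3L ∘L D).contDiff.add contDiff_const
  have hc3 : ∀ (p : Z2 × 𝒜 j.other) n, ContDiff ℝ ∞ fun x =>
      vecMollify (fun y => u j.other y p.2) n (E x + latPt A q θ j.other p.1) := fun p n =>
    (hcd j.other p.2 n).comp (E.contDiff.add contDiff_const)
  -- The summand 1 makes the constant at least 1, so it is bounded by each of its powers of order i
  -- ≥ 1.
  refine ⟨1 + ‖toR3L ∘L D‖ + M + M * (1 + ‖E‖) ^ k, by positivity, fun α p => ⟨fun n => ?_, ?_, ?_⟩⟩
  · rw [e]
    exact ((hc1 α p).add (hcd j α n)).sub (hc3 p n)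
  · intro n x i h1 h2
    have hle : ∀ {F : R2 → R3}, ContDiff ℝ ∞ F → ContDiffAt ℝ i F x := fun hF =>
      hF.contDiffAt.of_le (by exact_mod_cast le_top)
    rw [e, fun_iteratedFDeriv_sub_apply (hle ((hc1 α p).add (hcd j α n))) (hle (hc3 p n)),
      fun_iteratedFDeriv_add_apply (hle (hc1 α p)) (hle (hcd j α n))]
    have b1 := norm_iteratedFDeriv_affine_le (toR3L ∘L D)
      (toR3 (-latPt A q θ j.other p.1 + τ j α - τ j.other p.2)) h1 x
    have b2 := hM j α n x i h2
    have b3 := norm_iteratedFDeriv_comp_affine_le E (latPt A q θ j.other p.1) (hcd j.other p.2 n)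
      (fun y => hM j.other p.2 n y i h2) x
    have b4 : M * ‖E‖ ^ i ≤ M * (1 + ‖E‖) ^ k := by
      refine mul_le_mul_of_nonneg_left ?_ hM0
      calc ‖E‖ ^ i ≤ (1 + ‖E‖) ^ i := by gcongr; linarith
        _ ≤ (1 + ‖E‖) ^ k := pow_le_pow_right₀ (by linarith [norm_nonneg E]) h2
    refine (norm_sub_le _ _).trans ((add_le_add_left (norm_add_le _ _) _).trans ?_)
    have h3 : 0 ≤ M * (1 + ‖E‖) ^ k := by positivity
    refine le_trans ?_ (le_self_pow₀ (by linarith [norm_nonneg (toR3L ∘L D)]) (by omega))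
    linarith
  · intro x
    have hl := fun l α => (exists_vecMollify_bound (huc l α) (hu l α)).2.1
    exact ((tendsto_const_nhds.add (hl j α x)).sub (hl j.other p.2 _))

lemma isTranslationInvariant_pairPotential (v : 𝒜 .one → 𝒜 .two → R3 → ℝ) (j : Layer) (α : 𝒜 j) :
    IsTranslationInvariant (pairPotential v j α) := by
  intro a m
  simp only [pairPotential]
  congr 1
  exact ((Equiv.addRight m).prodCongr (Equiv.refl (𝒜 j.other))).tsum_eq
    fun p => pairSwap v j α p.2 (a p)

end Inter

/-! ### Lattice sums of pair potentials. -/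

section Inter

variable {𝒜 : Layer → Type*} [∀ k, Fintype (𝒜 k)]

lemma exists_layer_bound (f : ∀ k, 𝒜 k → ℝ) : ∃ B : ℝ, 0 ≤ B ∧ ∀ k α, f k α ≤ B := by
  have h : ∀ k, ∃ B : ℝ, 0 ≤ B ∧ ∀ α, f k α ≤ B := fun k =>
    ⟨∑ α, |f k α|, Finset.sum_nonneg fun _ _ => abs_nonneg _, fun α => (le_abs_self _).trans
      (Finset.single_le_sum (f := fun α => |f k α|) (fun _ _ => abs_nonneg _) (Finset.mem_univ α))⟩
  choose B hB0 hB using h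
  refine ⟨B .one + B .two, add_nonneg (hB0 _) (hB0 _), fun k α => (hB k α).trans ?_⟩
  cases k
  · linarith [hB0 .two]
  · linarith [hB0 .one]

/-- Lower bound of the stencil weights, uniform in displacements with a common bound. -/
lemma exists_mul_max_le_jap_interStencil {A : Mat2} (hA : IsUnit A.det) {q : ℝ} (hq : 0 < q)
    (θ : ℝ) (τ : ∀ k, 𝒜 k → R2) (j : Layer) {B ρ : ℝ} (hB : 0 ≤ B) (hρ : 0 ≤ ρ) :
    ∃ κ : ℝ, 0 < κ ∧ ∀ u : ∀ k, R2 → 𝒜 k → R3, (∀ k x α, ‖u k x α‖ ≤ B) → ∀ x y α p, ‖y‖ ≤ ρ →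
      κ * max 1 ‖p.1‖ ≤ jap (horL (interStencil A q θ τ j u x y α p)) := by
  obtain ⟨T, hT0, hT⟩ := exists_layer_bound fun k α => ‖τ k α‖
  obtain ⟨κ, hκ, h⟩ := exists_mul_max_le_jap hA hq θ j.other (ρ := ρ + 2 * T + 2 * B) (by positivity)
  refine ⟨κ, hκ, fun u hu x y α p hy => h _ _ ?_⟩
  refine (norm_latPt_le_norm_horL_interStencil A q θ τ j hu hT x y α p).trans ?_
  gcongr

/-- Lattice sums of a pair potential over the interlayer stencil: absolute convergence, continuity,
and a bound of `k`-th differences. -/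
theorem pair_lattice_sum {A : Mat2} (hA : IsUnit A.det) {q : ℝ} (hq : 0 < q) (θ : ℝ)
    (τ : ∀ k, 𝒜 k → R2) (j : Layer) {u : ∀ k, R2 → 𝒜 k → R3} {k : ℕ} {s L : ℝ} (hs : 2 < s)
    (hL : 0 ≤ L) (huc : ∀ l α, Continuous fun x => u l x α)
    (hu : ∀ l α (i : Fin 3), MemWeightedSobolev k 0 (univ : Set R2) fun x => u l x α i)
    {Z : Layer → ℝ} (hZ : ∀ l x α, |u l x α 2| ≤ Z l) (hZL : Z j + Z j.other ≤ L) (α : 𝒜 j)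
    {v : 𝒜 j.other → R3 → ℝ} (hv : ∀ β, MemSobolevSlab k s L (v β)) :
    (∀ x y, Summable fun p => v p.2 (interStencil A q θ τ j u x y α p)) ∧
    Continuous (fun x => ∑' p, v p.2 (interStencil A q θ τ j u x (act (disreg A q θ j) x) α p)) ∧
    ∀ ρ : ℝ, 0 ≤ ρ → ∃ C : ℝ, 0 ≤ C ∧ ∀ x h : R2, ‖x‖ + k * ‖h‖ ≤ ρ →
      |(fwdDiff h)^[k] (fun x => ∑' p, v p.2
        (interStencil A q θ τ j u x (act (disreg A q θ j) x) α p)) x| ≤ C * ‖h‖ ^ k := by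
  have hs0 : 0 ≤ s := by linarith
  have hmoll := fun l α => exists_vecMollify_bound (huc l α) (hu l α)
  choose M hM0 hMd hMv hMu using fun l α => (hmoll l α).2.2
  obtain ⟨B, hB0, hB⟩ := exists_layer_bound M
  obtain ⟨D, hD0, hD⟩ := isSmoothApprox_mollStencil A q θ τ j huc hu hB0
    fun l α n x i hi => (hMd l α n x i hi).trans (hB l α)
  have huB : ∀ l x α, ‖u l x α‖ ≤ B := fun l x α => (hMu l α x).trans (hB l α)
  have hUB : ∀ n l x α, ‖vecMollify (fun y => u l y α) n x‖ ≤ B := fun n l x α =>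
    (hMv l α n x).trans (hB l α)
  have hsten : ∀ x y (p : Z2 × 𝒜 j.other), |interStencil A q θ τ j u x y α p 2| ≤ L := by
    intro x y p
    rw [interStencil_apply_two]
    have h1 := hZ j x α
    have h2 := hZ j.other (x - y + latPt A q θ j.other p.1) p.2
    rw [abs_le] at h1 h2 ⊢
    constructor <;> linarith
  have hmsten : ∀ (p : Z2 × 𝒜 j.other) n x, |mollStencil A q θ τ j u α p n x 2| ≤ L := by
    intro p n x
    rw [mollStencil, interStencil_apply_two, vecMollify_apply, vecMollify_apply]
    have h1 := abs_mollify_le (fun x => hZ j x α) n x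
    have h2 := abs_mollify_le (fun x => hZ j.other x p.2) n
      (x - act (disreg A q θ j) x + latPt A q θ j.other p.1)
    rw [abs_le] at h1 h2 ⊢
    constructor <;> linarith
  choose P hP0 hPv hPd using fun β => (hv β).exists_fwdDiff_comp_bound hs0 hL
  set Q := ∑ β, P β with hQ
  have hPQ : ∀ β, P β ≤ Q := fun β => Finset.single_le_sum (fun b _ => hP0 b) (Finset.mem_univ β)
  have hQ0 : 0 ≤ Q := Finset.sum_nonneg fun b _ => hP0 b
  have hval : ∀ ρ : ℝ, 0 ≤ ρ → ∃ κ : ℝ, 0 < κ ∧ ∀ x y (p : Z2 × 𝒜 j.other), ‖y‖ ≤ ρ →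
      ‖v p.2 (interStencil A q θ τ j u x y α p)‖ ≤ Q * (1 / (κ * max 1 ‖p.1‖) ^ s) := by
    intro ρ hρ
    obtain ⟨κ, hκ, h⟩ := exists_mul_max_le_jap_interStencil hA hq θ τ j hB0 hρ
    refine ⟨κ, hκ, fun x y p hy => ?_⟩
    have h1 := h u huB x y α p hy
    have h2 := hPv p.2 _ (hsten x y p)
    have h3 : 0 < (κ * max 1 ‖p.1‖) ^ s := by positivity
    rw [mul_one_div, le_div_iff₀ h3, mul_comm, Real.norm_eq_abs]
    calc (κ * max 1 ‖p.1‖) ^ s * |v p.2 (interStencil A q θ τ j u x y α p)|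
        ≤ jap (horL (interStencil A q θ τ j u x y α p)) ^ s *
          |v p.2 (interStencil A q θ τ j u x y α p)| := by gcongr
      _ ≤ Q := h2.trans (hPQ _)
  have hsum : ∀ x y, Summable fun p => v p.2 (interStencil A q θ τ j u x y α p) := by
    intro x y
    obtain ⟨κ, hκ, h⟩ := hval ‖y‖ (norm_nonneg y)
    exact Summable.of_norm_bounded ((summable_one_div_max_rpow hκ hs).mul_left Q)
      fun p => h x y p le_rfl
  set N := ‖actL (disreg A q θ j)‖
  have hN : ∀ x, ‖act (disreg A q θ j) x‖ ≤ N * ‖x‖ := fun x => (actL (disreg A q θ j)).le_opNorm x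
  refine ⟨hsum, ?_, fun ρ hρ => ?_⟩
  · rw [continuous_iff_continuousAt]
    intro x
    -- The majorant depends on the size of the disregistry, so uniform convergence is used only on a
    -- ball around x.
    obtain ⟨κ, hκ, h⟩ := hval (N * (‖x‖ + 1)) (by positivity)
    have hc : ContinuousOn (fun x => ∑' p, v p.2
        (interStencil A q θ τ j u x (act (disreg A q θ j) x) α p))
        (Metric.closedBall 0 (‖x‖ + 1)) := by
      refine continuousOn_tsum (fun p => ?_) ((summable_one_div_max_rpow hκ hs).mul_left Q)
        fun p y hy => h y _ p ?_
      · refine (hv p.2).1.comp (Continuous.continuousOn ?_) fun y _ => hsten y _ p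
        have hD' := continuous_act (disreg A q θ j)
        have h1 := huc j α
        have h2 := (huc j.other p.2).comp
          ((continuous_id.sub hD').add (continuous_const (y := latPt A q θ j.other p.1)))
        exact ((toR3L.continuous.comp (((hD'.sub continuous_const).add continuous_const).sub
          continuous_const)).add h1).sub h2
      · refine (hN y).trans ?_
        rw [mem_closedBall_zero_iff] at hy
        gcongr
    refine hc.continuousAt (Metric.closedBall_mem_nhds_of_mem ?_)
    simp
  -- The radius covers the disregistry at every point within k‖h‖ of x. The lower bound is uniform
  -- in the displacements, hence valid for all mollifications.
  · obtain ⟨κ, hκ, h⟩ := exists_mul_max_le_jap_interStencil hA hq θ τ j hB0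
      (ρ := N * ρ) (by positivity)
    have hw := summable_one_div_max_rpow (ι := 𝒜 j.other) hκ hs
    refine ⟨Q * D ^ k * ∑' p : Z2 × 𝒜 j.other, 1 / (κ * max 1 ‖p.1‖) ^ s,
      mul_nonneg (by positivity) (tsum_nonneg fun p => by positivity), fun x h' hx => ?_⟩
    have hterm : ∀ p : Z2 × 𝒜 j.other, ‖(fwdDiff h')^[k] (v p.2 ∘ fun x =>
        interStencil A q θ τ j u x (act (disreg A q θ j) x) α p) x‖ ≤
        Q * D ^ k * (1 / (κ * max 1 ‖p.1‖) ^ s) * ‖h'‖ ^ k := by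
      intro p
      have hW : 0 < (κ * max 1 ‖p.1‖) ^ s := by positivity
      refine (hPd p.2 _ _ D _ x h' (hD α p) hD0 hW (hmsten p) fun n y hy => ?_).trans ?_
      · refine Real.rpow_le_rpow (by positivity) (h _ (hUB n) _ _ α p ?_) hs0
        refine (hN y).trans ?_
        rw [mem_closedBall_iff_norm] at hy
        have := norm_sub_norm_le y x
        gcongr
        linarith
      · rw [mul_one_div]
        gcongr
        exact hPQ _
    have hexp : HasSum (fun p : Z2 × 𝒜 j.other => (fwdDiff h')^[k] (v p.2 ∘ fun x =>
        interStencil A q θ τ j u x (act (disreg A q θ j) x) α p) x)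
        ((fwdDiff h')^[k] (fun x => ∑' p, v p.2
          (interStencil A q θ τ j u x (act (disreg A q θ j) x) α p)) x) := by
      simp_rw [fwdDiff_iter_eq_sum_shift]
      exact hasSum_sum fun i _ => (hsum _ _).hasSum.const_smul _
    rw [← hexp.tsum_eq, ← Real.norm_eq_abs]
    have := tsum_of_norm_bounded ((hw.hasSum.mul_left (Q * D ^ k)).mul_right (‖h'‖ ^ k)) hterm
    exact this

lemma memSobolevSlab_pairSwap {𝒜 : Layer → Type*} {k : ℕ} {s L : ℝ}
    {v : 𝒜 .one → 𝒜 .two → R3 → ℝ}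
    (hv : ∀ α β, MemSobolevSlab k s L (v α β)) (j : Layer) (α : 𝒜 j) (β : 𝒜 j.other) :
    MemSobolevSlab k s L (pairSwap v j α β) := by
  cases j
  · exact hv α β
  · exact hv β α

/-- Boundedness is essential: the real supremum of an unbounded family is 0 by convention. -/
lemma abs_apply_two_le_supZ {ι : Type*} {w : R2 → ι → R3} {B : ℝ} (hB : ∀ x α, ‖w x α‖ ≤ B)
    (x : R2) (α : ι) : |w x α 2| ≤ supZ w := by
  refine le_ciSup (f := fun p : R2 × ι => |w p.1 p.2 2|) ⟨B, ?_⟩ (x, α)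
  rintro _ ⟨p, rfl⟩
  exact (PiLp.norm_apply_le (w p.1 p.2) 2).trans (hB p.1 p.2)

lemma supZ_nonneg {ι : Type*} (w : R2 → ι → R3) : 0 ≤ supZ w :=
  Real.iSup_nonneg fun _ => abs_nonneg _

lemma supZ_add_supZ_le_slabHeight {𝒜 : Layer → Type*} (τ : ∀ k, 𝒜 k → R2)
    (u : ∀ k, R2 → 𝒜 k → R3) (j : Layer) :
    supZ (u j) + supZ (u j.other) ≤ slabHeight τ u := by
  have h : 0 ≤ sublatticeDist τ := Real.iSup_nonneg fun _ => norm_nonneg _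
  unfold slabHeight
  cases j
  · change supZ (u .one) + supZ (u .two) ≤ _
    linarith
  · change supZ (u .two) + supZ (u .one) ≤ _
    linarith

/-- The interlayer site potential of pair potentials is continuous, with `k`-th differences of
order `k`. -/
theorem interSite_pair {A : Mat2} (hA : IsUnit A.det) {q : ℝ} (hq : 0 < q) (θ : ℝ)
    (τ : ∀ k, 𝒜 k → R2) (j : Layer) {u : ∀ k, R2 → 𝒜 k → R3} {k : ℕ} {s : ℝ} (hs : 2 < s)
    (huc : ∀ l α, Continuous fun x => u l x α)
    (hu : ∀ l α (i : Fin 3), MemWeightedSobolev k 0 (univ : Set R2) fun x => u l x α i)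
    {v : 𝒜 .one → 𝒜 .two → R3 → ℝ} (hv : ∀ α β, MemSobolevSlab k s (slabHeight τ u) (v α β)) :
    (∀ x y α, Summable fun p => pairSwap v j α p.2 (interStencil A q θ τ j u x y α p)) ∧
    Continuous (interSite A q θ τ j (pairPotential v j) u) ∧
    ∀ ρ : ℝ, 0 ≤ ρ → ∃ C : ℝ, 0 ≤ C ∧ ∀ x h : R2, ‖x‖ + k * ‖h‖ ≤ ρ →
      |(fwdDiff h)^[k] (interSite A q θ τ j (pairPotential v j) u) x| ≤ C * ‖h‖ ^ k := by
  have hmoll := fun l α => exists_vecMollify_bound (huc l α) (hu l α)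
  choose M hM0 hMd hMv hMu using fun l α => (hmoll l α).2.2
  obtain ⟨B, hB0, hB⟩ := exists_layer_bound M
  have hZ : ∀ l x α, |u l x α 2| ≤ supZ (u l) := fun l x α =>
    abs_apply_two_le_supZ (fun x α => (hMu l α x).trans (hB l α)) x α
  have hZL := supZ_add_supZ_le_slabHeight τ u j
  have hL : 0 ≤ slabHeight τ u := (add_nonneg (supZ_nonneg _) (supZ_nonneg _)).trans hZL
  have key := fun α => pair_lattice_sum hA hq θ τ j hs hL huc hu hZ hZL α
    (memSobolevSlab_pairSwap hv j α)
  set F : 𝒜 j → R2 → ℝ := fun α x => ∑' p, pairSwap v j α p.2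
    (interStencil A q θ τ j u x (act (disreg A q θ j) x) α p) with hF
  have e : interSite A q θ τ j (pairPotential v j) u =
      ∑ α, (1 / cellArea A q θ j * (1 / 2)) • F α := by
    ext x
    simp only [interSite, interSiteTwo, pairPotential, Finset.sum_apply, Pi.smul_apply, smul_eq_mul,
      hF, Finset.mul_sum, mul_assoc]
  refine ⟨fun x y α => (key α).1 x y, ?_, fun ρ hρ => ?_⟩
  · have e' : (∑ α, (1 / cellArea A q θ j * (1 / 2)) • F α) =
        fun x => ∑ α, (1 / cellArea A q θ j * (1 / 2)) • F α x := by
      ext x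
      simp
    rw [e, e']
    exact continuous_finsetSum _ fun α _ => (key α).2.1.const_smul (1 / cellArea A q θ j * (1 / 2))
  · choose C hC0 hC using fun α => (key α).2.2 ρ hρ
    refine ⟨∑ α, |1 / cellArea A q θ j * (1 / 2)| * C α,
      Finset.sum_nonneg fun α _ => mul_nonneg (abs_nonneg _) (hC0 α), fun x h hx => ?_⟩
    rw [e, fwdDiff_iter_finsetSum, Finset.sum_apply, Finset.sum_mul]
    refine (Finset.abs_sum_le_sum_abs _ _).trans (Finset.sum_le_sum fun α _ => ?_)
    rw [fwdDiff_iter_const_smul, Pi.smul_apply, smul_eq_mul, abs_mul, mul_assoc]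
    exact mul_le_mul_of_nonneg_left (hC α x h hx) (abs_nonneg _)

end Inter

/-! ### Decay of Fourier coefficients from differences. -/

lemma toTorus_add (s t : Fin 2 → ℝ) : toTorus (s + t) = toTorus s + toTorus t := rfl

lemma toTorus_nsmul (k : ℕ) (t : Fin 2 → ℝ) : toTorus (k • t) = k • toTorus t := rfl

/-- Bounded representatives turn difference bounds on bounded sets into uniform ones on the torus.
-/
lemma exists_toTorus_eq (ξ : UnitAddTorus (Fin 2)) :
    ∃ t : Fin 2 → ℝ, ‖WithLp.toLp 2 t‖ ≤ 2 ∧ toTorus t = ξ := by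
  refine ⟨fun i => (AddCircle.equivIco 1 0 (ξ i) : ℝ), ?_, ?_⟩
  · have h : ∀ i, |(AddCircle.equivIco (1 : ℝ) 0 (ξ i) : ℝ)| ≤ 1 := fun i => by
      have := (AddCircle.equivIco (1 : ℝ) 0 (ξ i)).2
      rw [abs_le]
      constructor <;> linarith [this.1, this.2]
    rw [EuclideanSpace.norm_eq, Fin.sum_univ_two, Real.sqrt_le_left (by norm_num)]
    simp only [Real.norm_eq_abs]
    nlinarith [h 0, h 1, abs_nonneg (AddCircle.equivIco (1 : ℝ) 0 (ξ 0) : ℝ),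
      abs_nonneg (AddCircle.equivIco (1 : ℝ) 0 (ξ 1) : ℝ)]
  · ext i
    exact AddCircle.coe_equivIco

lemma fwdDiff_iter_toTorus {P : Mat2} {f : R2 → ℝ} {g : C(UnitAddTorus (Fin 2), ℂ)}
    (hg : ∀ t, g (toTorus t) = (f (act P (WithLp.toLp 2 t)) : ℂ)) (e t : Fin 2 → ℝ) (n : ℕ) :
    (fwdDiff (toTorus e))^[n] g (toTorus t) =
      (((fwdDiff (act P (WithLp.toLp 2 e)))^[n] f (act P (WithLp.toLp 2 t)) : ℝ) : ℂ) := by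
  rw [fwdDiff_iter_eq_sum_shift, fwdDiff_iter_eq_sum_shift, Complex.ofReal_sum]
  refine Finset.sum_congr rfl fun k _ => ?_
  rw [← toTorus_nsmul, ← toTorus_add, hg, WithLp.toLp_add, act_add,
    show act P (WithLp.toLp 2 (k • e)) = k • act P (WithLp.toLp 2 e) from
      map_nsmul (actL P) k (WithLp.toLp 2 e)]
  simp

lemma exists_norm_eq_abs (m : Z2) : ∃ i, ‖m‖ = |(m i : ℝ)| := by
  obtain ⟨i, hi⟩ := Finite.exists_max fun i => ‖m i‖
  refine ⟨i, le_antisymm ?_ ?_⟩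
  · rw [← Int.norm_eq_abs]
    exact (pi_norm_le_iff_of_nonneg (norm_nonneg _)).2 hi
  · rw [← Int.norm_eq_abs]
    exact norm_le_pi_norm m i

/-- Fourier coefficients of a periodic function with `k`-th differences of order `k`. -/
theorem exists_mFourierCoeff_le {P : Mat2} {f : R2 → ℝ} {g : C(UnitAddTorus (Fin 2), ℂ)}
    (hg : ∀ t, g (toTorus t) = (f (act P (WithLp.toLp 2 t)) : ℂ)) {k : ℕ}
    (hf : ∀ ρ : ℝ, 0 ≤ ρ → ∃ C : ℝ, 0 ≤ C ∧ ∀ x h : R2, ‖x‖ + k * ‖h‖ ≤ ρ →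
      |(fwdDiff h)^[k] f x| ≤ C * ‖h‖ ^ k) :
    ∃ C : ℝ, ∀ m : Z2, m ≠ 0 → ‖mFourierCoeff g m‖ ≤ C * ‖m‖ ^ (-(k : ℝ)) := by
  have hP : ∀ x, ‖act P x‖ ≤ ‖actL P‖ * ‖x‖ := fun x => (actL P).le_opNorm x
  -- The radius covers base points of norm at most 2 in torus coordinates and k steps of norm at
  -- most 1, all mapped by P.
  obtain ⟨C, hC0, hC⟩ := hf (‖actL P‖ * 2 + k * ‖actL P‖) (by positivity)
  refine ⟨C * ‖actL P‖ ^ k, fun m hm => ?_⟩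
  -- Differencing along the largest coordinate makes the step length 1/(2‖m‖).
  obtain ⟨i, hi⟩ := exists_norm_eq_abs m
  have hm1 := one_le_norm_Z2 hm
  have hmi : m i ≠ 0 := by
    rintro h0
    rw [hi, h0] at hm1
    norm_num at hm1
  have hstep : ‖WithLp.toLp 2 (Pi.single i (1 / (2 * (m i : ℝ))) : Fin 2 → ℝ)‖ = 1 / (2 * ‖m‖) := by
    have := PiLp.norm_single 2 (fun _ : Fin 2 => ℝ) i (1 / (2 * (m i : ℝ)))
    rw [hi]
    refine this.trans ?_
    rw [Real.norm_eq_abs, abs_div, abs_mul, abs_one, abs_two]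
  have hact : ‖act P (WithLp.toLp 2 (Pi.single i (1 / (2 * (m i : ℝ))) : Fin 2 → ℝ))‖ ≤
      ‖actL P‖ * (1 / (2 * ‖m‖)) := by
    rw [← hstep]; exact hP _
  have hle : 1 / (2 * ‖m‖) ≤ 1 := by
    rw [div_le_one (by positivity)]; linarith
  have h1 := two_pow_mul_norm_mFourierCoeff_le g m i hmi k
    (B := C * (‖actL P‖ * (1 / (2 * ‖m‖))) ^ k) fun ξ => by
      obtain ⟨t, ht, rfl⟩ := exists_toTorus_eq ξ
      rw [fwdDiff_iter_toTorus hg, Complex.norm_real, Real.norm_eq_abs]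
      refine (hC _ _ ?_).trans (by gcongr)
      gcongr
      · exact (hP _).trans (by gcongr)
      · exact hact.trans (mul_le_of_le_one_right (norm_nonneg _) hle)
  have h2 : (1 : ℝ) ≤ 2 ^ k := one_le_pow₀ one_le_two
  calc ‖mFourierCoeff g m‖ ≤ 2 ^ k * ‖mFourierCoeff g m‖ := le_mul_of_one_le_left (norm_nonneg _) h2
    _ ≤ C * (‖actL P‖ * (1 / (2 * ‖m‖))) ^ k := h1
    _ ≤ C * (‖actL P‖ * (1 / ‖m‖)) ^ k := by
      gcongr
      linarith
    _ = C * ‖actL P‖ ^ k * ‖m‖ ^ (-(k : ℝ)) := by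
      rw [mul_pow, Real.rpow_neg (norm_nonneg _), Real.rpow_natCast, one_div, inv_pow, mul_assoc]

lemma integrableOn_cell {f : R2 → ℝ} (hf : Continuous f) (P : Mat2) : IntegrableOn f (cell P) := by
  refine (hf.continuousOn.integrableOn_compact
    (isCompact_closedBall (0 : R2) (‖actL P‖ * 2))).mono_set ?_
  rintro _ ⟨t, ht, rfl⟩
  rw [mem_closedBall_zero_iff]
  refine ((actL P).le_opNorm t).trans ?_
  gcongr
  have h : ∀ i, |t i| ≤ 1 := fun i => by
    rw [abs_le]
    constructor <;> linarith [(ht i).1, (ht i).2]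
  rw [EuclideanSpace.norm_eq, Fin.sum_univ_two, Real.sqrt_le_left (by norm_num)]
  simp only [Real.norm_eq_abs]
  nlinarith [h 0, h 1, abs_nonneg (t 0), abs_nonneg (t 1)]

end MoireBilayer

/-! ### The convergence theorem. -/

open MoireBilayer
theorem theorem2p1 {𝒜 : Layer → Type*} [∀ k, Fintype (𝒜 k)]
    (A : Mat2) (hA : IsUnit A.det) (q θ K σ s : ℝ) (hq : 0 < q)
    (hθ : θ ∈ Set.Ico 0 (2 * Real.pi)) (hσ : 1433 / 1248 < σ) (hs : 1 < s)
    (hdio : IsDiophantineRotation A q θ K σ)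
    (τ : ∀ k, 𝒜 k → R2) (u : ∀ k, R2 → 𝒜 k → R3)
    (hu : ∀ k, IsPerDisplacement A q θ (u k)) (j : Layer) :
    -- monolayer many-body potentials
    (∀ V : 𝒜 j → (Z2 × 𝒜 j → R3) → ℝ,
      IsRegularSitePotential A q θ (2 * (σ + s)) (monoSite A q θ j V (u j)) →
      ∃ C : ℝ, 0 < C ∧ ∀ N : ℕ,
        |monoEnergyTrunc A q θ j V (u j) N - monoEnergy A q θ j V (u j)| ≤ C / (2 * N + 1)) ∧
    -- interlayer many-body potentials
    (∀ V : 𝒜 j → (Z2 × 𝒜 j.other → R3) → ℝ,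
      (∀ α, IsTranslationInvariant (V α)) → (∀ α a, V α (-a) = V α a) →
      IsRegularSitePotential A q θ (2 * (σ + s)) (interSite A q θ τ j V u) →
      ∃ C : ℝ, 0 < C ∧ ∀ N : ℕ,
        |interEnergyTrunc A q θ τ j V u N - interEnergy A q θ τ j V u| ≤ C / (2 * N + 1)) ∧
    -- interlayer pair potentials
    (∀ (v : 𝒜 .one → 𝒜 .two → R3 → ℝ) (r : ℝ), σ < 2 → 1 < r →
      (∀ α β x, v α β (-x) = v α β x) →
      (∀ k α (i : Fin 3), MemWeightedSobolev 6 0 (Set.univ : Set R2) fun x => u k x α i) →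
      (∀ α β, MemSobolevSlab 6 (2 * r) (slabHeight τ u) (v α β)) →
      (∀ x y α, Summable fun p => pairSwap v j α p.2 (interStencil A q θ τ j u x y α p)) ∧
      MeasureTheory.IntegrableOn (interSite A q θ τ j (pairPotential v j) u)
        (moireCell A q θ) ∧
      ∃ C : ℝ, 0 < C ∧ ∀ N : ℕ,
        |interEnergyTrunc A q θ τ j (pairPotential v j) u N -
          interEnergy A q θ τ j (pairPotential v j) u| ≤ C / (2 * N + 1)) := by
  have hP := isUnit_det_moireMat hA hq hdio
  refine ⟨fun V hV => ?_, fun V hV _ hreg => ?_, fun v r hσ2 hr _ huS hvS => ?_⟩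
  · simp_rw [monoEnergyTrunc_eq]
    exact exists_lattice_average_sub_le_of_regular hA hq hdio j
      (monoSite_periodic j V (hu j)) hs hV
  · simp_rw [interEnergyTrunc_eq hA hq θ τ j hV]
    exact exists_lattice_average_sub_le_of_regular hA hq hdio j
      (interSite_periodic hA hq hdio τ j hV hu) hs hreg
  · have hinv := isTranslationInvariant_pairPotential v j
    obtain ⟨hsum, hcont, hdiff⟩ := interSite_pair hA hq θ τ j (s := 2 * r) (by linarith)
      (fun k => (hu k).1) huS hvS
    obtain ⟨g, hg⟩ := exists_torus_lift (moireMat A q θ) hcont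
      (interSite_periodic hA hq hdio τ j hinv hu)
    obtain ⟨C, hC⟩ := exists_mFourierCoeff_le hg hdiff
    refine ⟨hsum, integrableOn_cell hcont _, ?_⟩
    simp_rw [interEnergyTrunc_eq hA hq θ τ j hinv]
    -- Six differences give decay exponent 6, and 6 - 2σ > 2 is exactly σ < 2.
    exact exists_lattice_average_sub_le hA hq hdio j hg (a := ((6 : ℕ) : ℝ))
      (by push_cast; linarith) hC
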